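/- All graphs are finite simplicial graphs whose edges $e$ are labelled by integers $m_e\ge 2$. The Artin group of such a labelled graph $\Gamma$ is $$A_\Gamma=\big\langle V(\Gamma)\ \big|\ \langle x,y\rangle^{m_e}=\langle y,x\rangle^{m_e}\ \text{ for each edge } e=\{x,y\} \text{ of } \Gamma\big\rangle,$$ where $\langle x,y\rangle^{m}=xyx\cdots$ is the alternating product with $m$ factors starting with $x$. A labelled subgraph $\Gamma_1\subseteq\Gamma_2$ (not necessarily full) consists of some of the vertices of $\Gamma_2$ and some of the edges of $\Gamma_2$ between them, with the labels of $\Gamma_2$; the inclusion on vertices induces a homomorphism $A_{\Gamma_1}\to A_{\Gamma_2}$. A group $G$ is poly-free if it has a finite chain of subgroups $1=G_0\unlhd G_1\unlhd\cdots\unlhd G_n=G$, each normal in the next, such that every quotient $G_{i}/G_{i-1}$ is a free group of possibly infinite rank; it is normally poly-free if such a chain exists with every $G_i$ normal in $G$. It is virtually poly-free (resp. virtually normally poly-free) if it has a finite-index subgroup that is poly-free (resp. normally poly-free). (1) Let $\Gamma_1\subseteq\Gamma_2$ be labelled graphs with $V(\Gamma_1)=V(\Gamma_2)$ such that $\Gamma_2$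 is obtained from $\Gamma_1$ by adding one labelled edge, and let $f\colon A_{\Gamma_1}\to A_{\Gamma_2}$ be the induced homomorphism. Then $\ker(f)$ is a free group (of possibly infinite rank). (2) Let $\Gamma_1\subseteq\Gamma_2$ be any labelled subgraph. If $A_{\Gamma_2}$ is poly-free (resp. normally poly-free, virtually poly-free, virtually normally poly-free), then so is $A_{\Gamma_1}$. -/

import Mathlib

universe u v

/-- A simplicial graph on the vertex set `V` whose edges are labelled by integers `≥ 2`. -/
structure LabelledGraph (V : Type u) where
  graph : SimpleGraph V
  label : graph.EdgeLabeling ℕ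
  two_le_label : ∀ e, 2 ≤ label e

/-- The alternating product `a * b * a * ⋯` with `n` factors, starting with `a`. -/
def alternatingProd {G : Type u} [Group G] (a b : G) : ℕ → G
  | 0 => 1
  | n + 1 => a * alternatingProd b a n

theorem map_alternatingProd {G : Type u} {H : Type v} [Group G] [Group H] (f : G →* H) (n : ℕ) :
    ∀ a b : G, f (alternatingProd a b n) = alternatingProd (f a) (f b) n := by
  induction n with
  | zero => intro a b; simp [alternatingProd]
  | succ n ih => intro a b; simp [alternatingProd, ih]

namespace LabelledGraph

/-- The relators `⟨x, y⟩^m * (⟨y, x⟩^m)⁻¹` of the Artin group, for `x`, `y` the two vertices of an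
edge with label `m`. -/
def artinRelators {V : Type u} (Γ : LabelledGraph V) : Set (FreeGroup V) :=
  {r | ∃ (x y : V) (h : Γ.graph.Adj x y),
    r = alternatingProd (FreeGroup.of x) (FreeGroup.of y) (Γ.label.get x y h) *
      (alternatingProd (FreeGroup.of y) (FreeGroup.of x) (Γ.label.get x y h))⁻¹}

/-- The Artin group of a labelled graph, defined by its standard presentation. -/
abbrev ArtinGroup {V : Type u} (Γ : LabelledGraph V) : Type u :=
  PresentedGroup Γ.artinRelators

/-- An inclusion of labelled graphs: an injective graph homomorphism preserving the labels. It
exhibits `Γ₁` as a (not necessarily full) labelled subgraph of `Γ₂`. -/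
structure Inclusion {V : Type u} {W : Type v} (Γ₁ : LabelledGraph V) (Γ₂ : LabelledGraph W) where
  toFun : V → W
  injective : Function.Injective toFun
  map_adj : ∀ {x y : V}, Γ₁.graph.Adj x y → Γ₂.graph.Adj (toFun x) (toFun y)
  map_label : ∀ {x y : V} (h : Γ₁.graph.Adj x y),
    Γ₂.label.get (toFun x) (toFun y) (map_adj h) = Γ₁.label.get x y h

/-- The homomorphism of Artin groups induced by an inclusion of labelled graphs; it sends the
generator of a vertex to the generator of its image. -/
def Inclusion.artinMap {V : Type u} {W : Type v} {Γ₁ : LabelledGraph V} {Γ₂ : LabelledGraph W}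
    (i : Inclusion Γ₁ Γ₂) : Γ₁.ArtinGroup →* Γ₂.ArtinGroup :=
  PresentedGroup.toGroup (f := fun x => PresentedGroup.of (i.toFun x)) (by
    rintro r ⟨x, y, h, rfl⟩
    have key : (PresentedGroup.mk Γ₂.artinRelators)
        (alternatingProd (FreeGroup.of (i.toFun x)) (FreeGroup.of (i.toFun y))
            (Γ₁.label.get x y h) *
          (alternatingProd (FreeGroup.of (i.toFun y)) (FreeGroup.of (i.toFun x))
            (Γ₁.label.get x y h))⁻¹) = 1 :=
      PresentedGroup.one_of_mem
        ⟨i.toFun x, i.toFun y, i.map_adj h, by rw [i.map_label h]⟩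
    rw [map_mul, map_inv, map_alternatingProd, map_alternatingProd] at key ⊢
    simp only [FreeGroup.lift_apply_of]
    exact key)

theorem Inclusion.artinMap_of {V : Type u} {W : Type v} {Γ₁ : LabelledGraph V}
    {Γ₂ : LabelledGraph W} (i : Inclusion Γ₁ Γ₂) (x : V) :
    i.artinMap (PresentedGroup.of x) = PresentedGroup.of (i.toFun x) :=
  PresentedGroup.toGroup.of _

/-- `Γ₂` is obtained from `Γ₁` by adding one new labelled edge, joining the distinct vertices `a`
and `b`, which are not adjacent in `Γ₁`; the vertex set and all other edges and labels are
unchanged. -/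
structure AddsEdge {V : Type u} (Γ₁ Γ₂ : LabelledGraph V) (a b : V) : Prop where
  ne : a ≠ b
  not_adj : ¬ Γ₁.graph.Adj a b
  adj_iff : ∀ x y : V, Γ₂.graph.Adj x y ↔ Γ₁.graph.Adj x y ∨ s(x, y) = s(a, b)
  label_eq : ∀ (x y : V) (h : Γ₁.graph.Adj x y),
    Γ₂.label.get x y ((adj_iff x y).2 (Or.inl h)) = Γ₁.label.get x y h

/-- The inclusion of `Γ₁` in the graph `Γ₂` obtained by adding an edge: the identity on vertices. -/
def AddsEdge.inclusion {V : Type u} {Γ₁ Γ₂ : LabelledGraph V} {a b : V}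
    (h : AddsEdge Γ₁ Γ₂ a b) : Inclusion Γ₁ Γ₂ where
  toFun := id
  injective := Function.injective_id
  map_adj hxy := (h.adj_iff _ _).2 (Or.inl hxy)
  map_label hxy := h.label_eq _ _ hxy

end LabelledGraph

/-- `G` is poly-free: there is a chain `1 = C 0 ⊴ C 1 ⊴ ⋯ ⊴ C n = G` of subgroups, each normal in
the next one, with free quotients `C (i + 1) / C i` (of possibly infinite rank). -/
def IsPolyFree (G : Type u) [Group G] : Prop :=
  ∃ (n : ℕ) (C : ℕ → Subgroup G), C 0 = ⊥ ∧ C n = ⊤ ∧ ∀ i < n, C i ≤ C (i + 1) ∧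
    ∃ _ : ((C i).subgroupOf (C (i + 1))).Normal,
      IsFreeGroup (C (i + 1) ⧸ (C i).subgroupOf (C (i + 1)))

/-- `G` is normally poly-free: there is a chain as in the definition of poly-free groups whose
members are all normal in `G`. -/
def IsNormallyPolyFree (G : Type u) [Group G] : Prop :=
  ∃ (n : ℕ) (C : ℕ → Subgroup G), C 0 = ⊥ ∧ C n = ⊤ ∧ (∀ i ≤ n, (C i).Normal) ∧
    ∀ i < n, C i ≤ C (i + 1) ∧
      ∃ _ : ((C i).subgroupOf (C (i + 1))).Normal,
        IsFreeGroup (C (i + 1) ⧸ (C i).subgroupOf (C (i + 1)))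

/-- `G` has a poly-free subgroup of finite index. -/
def IsVirtuallyPolyFree (G : Type u) [Group G] : Prop :=
  ∃ H : Subgroup G, H.FiniteIndex ∧ IsPolyFree H

/-- `G` has a normally poly-free subgroup of finite index. -/
def IsVirtuallyNormallyPolyFree (G : Type u) [Group G] : Prop :=
  ∃ H : Subgroup G, H.FiniteIndex ∧ IsNormallyPolyFree H

/-!
Suppose that an amalgam of groups acts on a set `Q` and that every factor acts freely. Each factor
then has an equivariant potential on `Q`, these potentials can be lifted to a free group mapping
onto the amalgam, and their coboundaries define a homomorphism from the amalgam to the wreath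
product of the free group and the amalgam over `Q`. Evaluated at a point, it embeds the stabilizer
of that point in the free group. Hence a homomorphism from an amalgam that is injective on the
factors has a free kernel.

If `Γ₂` is obtained from `Γ₁` by adding the edge `{a, b}`, then `A_Γ₁` is the amalgam of the Artin
groups of the full subgraphs on `V ∖ {a}` and `V ∖ {b}` over that of `V ∖ {a, b}`. These two
subgraphs are also full in `Γ₂`, so (1) reduces to van der Lek's theorem that the Artin group of a
full subgraph embeds. To prove it, let `T` be the set of vertices of the subgraph and map the Artin
group to the wreath product of the Artin group of the subgraph and the Coxeter group `W` over
`W / W_T`. In terms of the representatives of minimal length, an edge of the Schreier graph of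
`W / W_T` is either trivial or reads a letter of `T`, and a path reading a reduced word reads a
reduced word in `T`. The braid relations in the wreath product thus follow from Matsumoto's theorem,
and evaluation at the coset `W_T` recovers the generators of the subgraph.

Finally, the four versions of poly-freeness are inherited along homomorphisms with free kernel, and
a subgraph arises from a full one by deleting edges one at a time.
-/

section GeometricRepresentation

variable {B : Type*} (M : CoxeterMatrix B)

/-- The square root `exp (π i / m)` of a primitive `m`-th root of unity, where `m = M i j`. Division
by zero makes it `1` for `m = 0`, that is, when the product of the two generators has infinite
order. -/
noncomputable def geometricRoot (i j : B) : ℂ :=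
  Complex.exp (Real.pi * Complex.I / M i j)

/-- The linear form `v ↦ 2 ⟨αᵢ, v⟩` of the complexified geometric representation; its value at `αⱼ`
is `-2 cos (π / M i j)`, written as a sum of two exponentials. -/
noncomputable def geometricCoroot (i : B) : Module.Dual ℂ (B →₀ ℂ) :=
  Finsupp.linearCombination ℂ fun j => -(geometricRoot M i j + (geometricRoot M i j)⁻¹)

/-- The simple reflections of the complexified geometric representation. -/
noncomputable def geometricReflection (i : B) : Module.End ℂ (B →₀ ℂ) :=
  Module.preReflection (Finsupp.single i 1) (geometricCoroot M i)

theorem geometricRoot_ne_zero (i j : B) : geometricRoot M i j ≠ 0 :=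
  Complex.exp_ne_zero _

theorem geometricRoot_self (i : B) : geometricRoot M i i = -1 := by
  simp [geometricRoot, Complex.exp_pi_mul_I]

theorem geometricRoot_comm (i j : B) : geometricRoot M i j = geometricRoot M j i := by
  rw [geometricRoot, geometricRoot, M.symmetric]

theorem isPrimitiveRoot_geometricRoot_sq {i j : B} (h : M i j ≠ 0) :
    IsPrimitiveRoot (geometricRoot M i j ^ 2) (M i j) := by
  convert Complex.isPrimitiveRoot_exp (M i j) h using 1
  rw [geometricRoot, ← Complex.exp_nat_mul]
  congr 1
  push_cast
  ring

theorem geometricCoroot_single (i j : B) : geometricCoroot M i (Finsupp.single j 1) =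
    -(geometricRoot M i j + (geometricRoot M i j)⁻¹) := by
  simp [geometricCoroot]

theorem geometricCoroot_single_self (i : B) : geometricCoroot M i (Finsupp.single i 1) = 2 := by
  rw [geometricCoroot_single, geometricRoot_self]
  norm_num

theorem geometricReflection_mul_apply (i j : B) {ζ : ℂ} (hζ : ζ ≠ 0)
    (h : geometricRoot M i j + (geometricRoot M i j)⁻¹ = ζ + ζ⁻¹) :
    (geometricReflection M i * geometricReflection M j)
        (Finsupp.single i 1 + ζ⁻¹ • Finsupp.single j 1) =
      ζ ^ 2 • (Finsupp.single i 1 + ζ⁻¹ • Finsupp.single j 1) := by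
  have hj : geometricCoroot M j (Finsupp.single i 1) = -(ζ + ζ⁻¹) := by
    rw [geometricCoroot_single, geometricRoot_comm, h]
  simp only [geometricReflection, Module.End.mul_apply, Module.preReflection_apply, map_add,
    map_sub, map_smul, hj, geometricCoroot_single_self, geometricCoroot_single M i j, h]
  match_scalars <;> field_simp <;> ring

theorem geometricReflection_mul_pow_apply (i j : B) {ζ : ℂ} (hζ : ζ ≠ 0)
    (h : geometricRoot M i j + (geometricRoot M i j)⁻¹ = ζ + ζ⁻¹) (n : ℕ) :
    ((geometricReflection M i * geometricReflection M j) ^ n)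
        (Finsupp.single i 1 + ζ⁻¹ • Finsupp.single j 1) =
      (ζ ^ 2) ^ n • (Finsupp.single i 1 + ζ⁻¹ • Finsupp.single j 1) := by
  induction n with
  | zero => simp
  | succ n ih =>
    rw [pow_succ, Module.End.mul_apply, geometricReflection_mul_apply M i j hζ h, map_smul, ih,
      smul_smul, ← pow_succ']

theorem sum_geometricReflection_mul_pow_apply {i j : B} (h0 : M i j ≠ 0) (h1 : M i j ≠ 1) {ζ : ℂ}
    (hζ : IsPrimitiveRoot (ζ ^ 2) (M i j))
    (h : geometricRoot M i j + (geometricRoot M i j)⁻¹ = ζ + ζ⁻¹) :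
    (∑ n ∈ Finset.range (M i j), (geometricReflection M i * geometricReflection M j) ^ n)
      (Finsupp.single i 1 + ζ⁻¹ • Finsupp.single j 1) = 0 := by
  have hζ0 : ζ ≠ 0 := fun h => hζ.ne_zero h0 (by simp [h])
  simp only [LinearMap.sum_apply, geometricReflection_mul_pow_apply M i j hζ0 h,
    ← Finset.sum_smul, hζ.geom_sum_eq_zero (by lia), zero_smul]

theorem isLiftable_geometricReflection : M.IsLiftable (geometricReflection M) := by
  intro i j
  rcases eq_or_ne i j with rfl | hij
  · rw [M.diagonal, pow_one]
    exact LinearMap.ext fun v =>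
      Module.involutive_preReflection (geometricCoroot_single_self M i) v
  rcases eq_or_ne (M i j) 0 with h0 | h0
  · rw [h0, pow_zero]
  -- `N` kills the eigenvectors of `R` for `η ^ 2` and `η⁻¹ ^ 2`, which span the plane containing
  -- the image of `R - 1`; hence `R ^ M i j - 1 = N * (R - 1)` vanishes.
  set R := geometricReflection M i * geometricReflection M j with hR
  set N := ∑ n ∈ Finset.range (M i j), R ^ n
  set η := geometricRoot M i j
  have hη0 : η ≠ 0 := geometricRoot_ne_zero M i j
  have hroot : IsPrimitiveRoot (η ^ 2) (M i j) := isPrimitiveRoot_geometricRoot_sq M h0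
  have hM1 : M i j ≠ 1 := M.off_diagonal i j hij
  have hη : η ≠ η⁻¹ := fun h => hM1 (hroot.unique (by
    rw [sq]
    nth_rw 2 [h]
    rw [mul_inv_cancel₀ hη0]
    exact .one))
  have hv : N (Finsupp.single i 1 + η⁻¹ • Finsupp.single j 1) = 0 :=
    sum_geometricReflection_mul_pow_apply M h0 hM1 hroot rfl
  have hv' : N (Finsupp.single i 1 + η⁻¹⁻¹ • Finsupp.single j 1) = 0 :=
    sum_geometricReflection_mul_pow_apply M h0 hM1 (by rw [inv_pow]; exact hroot.inv) (by
      rw [inv_inv, add_comm])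
  rw [map_add, map_smul] at hv hv'
  rw [inv_inv] at hv'
  have hNj : N (Finsupp.single j 1) = 0 := by
    have h := add_left_cancel (hv'.trans hv.symm)
    rw [← sub_eq_zero, ← sub_smul] at h
    exact (smul_eq_zero.1 h).resolve_left (sub_ne_zero.2 hη)
  have hNi : N (Finsupp.single i 1) = 0 := by simpa [hNj] using hv
  have hspan (u : B →₀ ℂ) : N (R u - u) = 0 := by
    simp only [hR, geometricReflection, Module.End.mul_apply, Module.preReflection_apply,
      map_sub, map_smul, hNi, hNj, smul_zero, sub_zero, sub_self]
  exact sub_eq_zero.1 ((geom_sum_mul R _).symm.trans (LinearMap.ext hspan))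

theorem geometricReflection_mul_pow_apply_single {i j : B} (h : M i j = 0) (n : ℕ) :
    ((geometricReflection M i * geometricReflection M j) ^ n) (Finsupp.single i 1) =
      Finsupp.single i 1 + (2 * n : ℂ) • (Finsupp.single i 1 + Finsupp.single j 1) := by
  have hη : geometricRoot M i j = 1 := by simp [geometricRoot, h]
  have hv := geometricReflection_mul_pow_apply M i j one_ne_zero (by rw [hη]) 1
  have hi : (geometricReflection M i * geometricReflection M j) (Finsupp.single i 1) =
      Finsupp.single i 1 + (2 : ℂ) • (Finsupp.single i 1 + Finsupp.single j 1) := by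
    simp only [geometricReflection, Module.End.mul_apply, Module.preReflection_apply, map_sub,
      map_smul, geometricCoroot_single_self, geometricCoroot_single M i j,
      geometricCoroot_single M j i, geometricRoot_comm M j i, hη]
    match_scalars <;> norm_num
  simp only [inv_one, one_smul, one_pow, pow_one] at hv
  induction n with
  | zero => simp
  | succ n ih =>
    rw [pow_succ', Module.End.mul_apply, ih, map_add, map_smul, hv, hi, add_assoc, ← add_smul]
    push_cast
    ring_nf

theorem dvd_of_geometricReflection_mul_pow_eq_one {i j : B} {n : ℕ}
    (h : (geometricReflection M i * geometricReflection M j) ^ n = 1) : M i j ∣ n := by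
  set η := geometricRoot M i j
  have hη0 : η ≠ 0 := geometricRoot_ne_zero M i j
  rcases eq_or_ne i j with rfl | hij
  · simp
  have hpow := geometricReflection_mul_pow_apply M i j hη0 rfl
  rcases eq_or_ne (M i j) 0 with h0 | h0
  · have hn := DFunLike.congr_fun (h ▸ geometricReflection_mul_pow_apply_single M h0 n) j
    have : n = 0 := by simpa [hij] using hn
    rw [this]
    exact dvd_zero _
  · refine (isPrimitiveRoot_geometricRoot_sq M h0).dvd_of_pow_eq_one _ ?_
    have := DFunLike.congr_fun (h ▸ hpow n) i
    simpa [hij] using this.symm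

variable {M} {W : Type*} [Group W] (cs : CoxeterSystem M W)

theorem orderOf_simple_mul_simple (i j : B) :
    orderOf (cs.simple i * cs.simple j) = M i j := by
  refine Nat.dvd_antisymm (orderOf_dvd_of_pow_eq_one (cs.simple_mul_simple_pow i j)) ?_
  apply dvd_of_geometricReflection_mul_pow_eq_one
  have h := congrArg (cs.lift ⟨_, isLiftable_geometricReflection M⟩)
    (pow_orderOf_eq_one (cs.simple i * cs.simple j))
  simpa only [map_pow, map_mul, map_one, cs.lift_apply_simple] using h

theorem simple_injective : Function.Injective cs.simple := by
  intro i j hij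
  by_contra hne
  apply M.off_diagonal i j hne
  rw [← orderOf_simple_mul_simple cs, hij, cs.simple_mul_simple_self, orderOf_one]

end GeometricRepresentation

section AlternatingWords

/-- The alternating word `x y x ⋯` with `n` letters. It starts with `x`, in accordance with
`alternatingProd`, whereas `CoxeterSystem.alternatingWord` prescribes the last letter. -/
def alternatingList {B : Type*} (x y : B) : ℕ → List B
  | 0 => []
  | n + 1 => x :: alternatingList y x n

theorem mem_pair_of_mem_alternatingList {B : Type*} {x y z : B} {n : ℕ}
    (h : z ∈ alternatingList x y n) : z ∈ ({x, y} : Set B) := by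
  induction n generalizing x y with
  | zero => cases h
  | succ n ih =>
    obtain rfl | h := List.mem_cons.1 h
    · exact Set.mem_insert _ _
    · exact Set.pair_comm y x ▸ ih h

theorem prod_map_alternatingList {B : Type*} {K : Type u} [Group K] (κ : B → K) (x y : B) (n : ℕ) :
    ((alternatingList x y n).map κ).prod = alternatingProd (κ x) (κ y) n := by
  induction n generalizing x y with
  | zero => rfl
  | succ n ih => simp [alternatingList, alternatingProd, ih]

theorem alternatingProd_two_mul {G : Type u} [Group G] (a b : G) (n : ℕ) :
    alternatingProd a b (2 * n) = (a * b) ^ n := by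
  induction n with
  | zero => rw [pow_zero]; rfl
  | succ n ih => rw [Nat.mul_succ, pow_succ', ← ih, mul_assoc]; rfl

theorem alternatingProd_eq_pow_mul {G : Type u} [Group G] {a b : G} (ha : a * a = 1)
    (hb : b * b = 1) (n : ℕ) :
    alternatingProd a b n = (a * b) ^ n * alternatingProd b a n := by
  induction n generalizing a b with
  | zero => rw [pow_zero, one_mul]; rfl
  | succ n ih =>
    calc alternatingProd a b (n + 1) = a * ((b * a) ^ n * alternatingProd a b n) := by
          rw [alternatingProd, ih hb ha]
      _ = (a * b) ^ n * a * (b * b) * alternatingProd a b n := by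
          rw [hb, mul_one, mul_pow_mul, mul_assoc]
      _ = (a * b) ^ (n + 1) * alternatingProd b a (n + 1) := by
          simp only [alternatingProd, pow_succ, mul_assoc]

end AlternatingWords

section StrongExchange

variable {B : Type*} {W : Type u} [Group W] {M : CoxeterMatrix B} (cs : CoxeterSystem M W)

theorem leftInvSeq_alternatingList (x y : B) (n : ℕ) :
    cs.leftInvSeq (alternatingList x y n) =
      (List.range n).map fun k => (cs.simple x * cs.simple y) ^ k * cs.simple x := by
  induction n generalizing x y with
  | zero => rfl
  | succ n ih =>
    rw [alternatingList, CoxeterSystem.leftInvSeq, ih, List.range_succ_eq_map, List.map_cons,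
      List.map_map, List.map_map, pow_zero, one_mul]
    refine congrArg _ (List.map_congr_left fun k _ => ?_)
    simp only [Function.comp_apply, MulAut.conj_apply, cs.inv_simple, Nat.succ_eq_add_one]
    rw [← mul_assoc, ← mul_pow_mul, pow_succ]
    simp only [mul_assoc]

theorem leftInvSeq_append (ω ω' : List B) : cs.leftInvSeq (ω ++ ω') =
    cs.leftInvSeq ω ++ (cs.leftInvSeq ω').map (MulAut.conj (cs.wordProd ω)) := by
  induction ω with
  | nil => simp
  | cons i ω ih =>
    simp [CoxeterSystem.leftInvSeq, ih, cs.wordProd_cons, Function.comp_def]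

open Classical in
/-- The action of a simple reflection `s i` on pairs of a group element and a sign: the element is
conjugated by `s i`, and the sign is changed if the element is `s i`. -/
noncomputable def signedConj (i : B) : Equiv.Perm (W × ZMod 2) :=
  Function.Involutive.toPerm
    (fun p => (cs.simple i * p.1 * cs.simple i, p.2 + if p.1 = cs.simple i then 1 else 0)) (by
      rintro ⟨t, ε⟩
      have h : cs.simple i * t * cs.simple i = cs.simple i ↔ t = cs.simple i := by
        rw [mul_assoc, mul_eq_left, mul_eq_one_iff_eq_inv, cs.inv_simple]
      ext
      · simp [mul_assoc]
      · simp [h, add_assoc, CharTwo.add_self_eq_zero])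

theorem signedConj_inv (i : B) : (signedConj cs i)⁻¹ = signedConj cs i := rfl

open Classical in
theorem signedConj_apply (i : B) (t : W) (ε : ZMod 2) :
    signedConj cs i (t, ε) =
      (cs.simple i * t * cs.simple i, ε + if t = cs.simple i then 1 else 0) := rfl

open Classical in
theorem prod_map_signedConj_inv_apply (ω : List B) (t : W) (ε : ZMod 2) :
    (ω.map (signedConj cs)).prod⁻¹ (t, ε) =
      ((cs.wordProd ω)⁻¹ * t * cs.wordProd ω, ε + (cs.leftInvSeq ω).count t) := by
  induction ω generalizing t ε with
  | nil => simp
  | cons i ω ih =>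
    have hcount : List.count (cs.simple i * t * cs.simple i) (cs.leftInvSeq ω) =
        List.count t ((cs.leftInvSeq ω).map (MulAut.conj (cs.simple i))) := by
      rw [← List.count_map_of_injective _ _ (MulAut.conj (cs.simple i)).injective]
      congr 1
      simp [mul_assoc]
    rw [List.map_cons, List.prod_cons, mul_inv_rev, signedConj_inv, Equiv.Perm.mul_apply,
      signedConj_apply, ih, CoxeterSystem.leftInvSeq, List.count_cons, hcount, cs.wordProd_cons]
    ext1
    · simp [mul_assoc]
    · simp only [beq_iff_eq, eq_comm (a := cs.simple i)]
      push_cast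
      ring

theorem isLiftable_signedConj : M.IsLiftable (signedConj cs) := by
  classical
  intro i j
  rw [← alternatingProd_two_mul, ← prod_map_alternatingList, ← inv_eq_one]
  refine Equiv.ext fun ⟨t, ε⟩ => ?_
  have hprod : cs.wordProd (alternatingList i j (2 * M i j)) = 1 := by
    rw [CoxeterSystem.wordProd, prod_map_alternatingList, alternatingProd_two_mul,
      cs.simple_mul_simple_pow]
  have hcount : (cs.leftInvSeq (alternatingList i j (2 * M i j))).count t =
      2 * (cs.leftInvSeq (alternatingList i j (M i j))).count t := by
    simp only [leftInvSeq_alternatingList, two_mul, List.range_add, List.map_append, List.map_map,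
      List.count_append, Function.comp_def, pow_add, cs.simple_mul_simple_pow, one_mul]
  rw [prod_map_signedConj_inv_apply, hprod, hcount]
  simp [CharTwo.two_eq_zero]

/-- The parity of the number of occurrences of `t` in the left inversion sequence of a word
representing `w`; it does not depend on the word. For a reflection `t` it is `1` exactly when `t` is
a left inversion of `w`. -/
noncomputable def inversionParity (w t : W) : ZMod 2 :=
  (cs.lift ⟨signedConj cs, isLiftable_signedConj cs⟩ w⁻¹ (t, 0)).2

theorem lift_signedConj_wordProd (ω : List B) :
    cs.lift ⟨signedConj cs, isLiftable_signedConj cs⟩ (cs.wordProd ω) =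
      (ω.map (signedConj cs)).prod := by
  rw [CoxeterSystem.wordProd, map_list_prod, List.map_map]
  congr 2
  exact funext fun i => cs.lift_apply_simple (isLiftable_signedConj cs) i

open Classical in
theorem inversionParity_wordProd (ω : List B) (t : W) :
    inversionParity cs (cs.wordProd ω) t = (cs.leftInvSeq ω).count t := by
  rw [inversionParity, map_inv, lift_signedConj_wordProd, prod_map_signedConj_inv_apply, zero_add]

open Classical in
theorem inversionParity_simple (i : B) (t : W) :
    inversionParity cs (cs.simple i) t = if cs.simple i = t then 1 else 0 := by
  have h := inversionParity_wordProd cs [i] t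
  simpa [List.count_singleton] using h

theorem inversionParity_mul (u v t : W) :
    inversionParity cs (u * v) t =
      inversionParity cs u t + inversionParity cs v (u⁻¹ * t * u) := by
  classical
  obtain ⟨ω, rfl⟩ := cs.wordProd_surjective u
  obtain ⟨ω', rfl⟩ := cs.wordProd_surjective v
  rw [inversionParity, mul_inv_rev, map_mul, Equiv.Perm.mul_apply, map_inv, map_inv,
    lift_signedConj_wordProd, lift_signedConj_wordProd, prod_map_signedConj_inv_apply,
    prod_map_signedConj_inv_apply, inversionParity_wordProd, inversionParity_wordProd, zero_add]

variable {cs}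

theorem mem_leftInvSeq_iff_of_nodup {ω : List B} (hω : (cs.leftInvSeq ω).Nodup) {t : W} :
    t ∈ cs.leftInvSeq ω ↔ inversionParity cs (cs.wordProd ω) t = 1 := by
  classical
  rw [inversionParity_wordProd]
  by_cases ht : t ∈ cs.leftInvSeq ω
  · simp [List.count_eq_one_of_mem hω ht, ht]
  · simp [List.count_eq_zero_of_not_mem ht, ht]

theorem isReduced_iff_nodup_leftInvSeq {ω : List B} :
    cs.IsReduced ω ↔ (cs.leftInvSeq ω).Nodup := by
  refine ⟨fun h => h.nodup_leftInvSeq, fun hω => ?_⟩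
  obtain ⟨ω', hω', h⟩ := cs.exists_isReduced (cs.wordProd ω)
  have hperm : (cs.leftInvSeq ω).Perm (cs.leftInvSeq ω') :=
    (List.perm_ext_iff_of_nodup hω hω'.nodup_leftInvSeq).2 fun t => by
      rw [mem_leftInvSeq_iff_of_nodup hω, mem_leftInvSeq_iff_of_nodup hω'.nodup_leftInvSeq, h]
  have hlength := hperm.length_eq
  rw [cs.length_leftInvSeq, cs.length_leftInvSeq] at hlength
  rw [CoxeterSystem.IsReduced, h, hω'.eq, hlength]

theorem mem_leftInvSeq_iff {ω : List B} (hω : cs.IsReduced ω) {t : W} :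
    t ∈ cs.leftInvSeq ω ↔ inversionParity cs (cs.wordProd ω) t = 1 :=
  mem_leftInvSeq_iff_of_nodup hω.nodup_leftInvSeq

theorem inversionParity_eq_zero_iff {w t : W} :
    inversionParity cs w t = 0 ↔ inversionParity cs w t ≠ 1 := by
  generalize inversionParity cs w t = ε
  revert ε
  decide

theorem length_mul_lt_of_inversionParity_eq_one {w t : W} (h : inversionParity cs w t = 1) :
    cs.length (t * w) < cs.length w := by
  obtain ⟨ω, hω, rfl⟩ := cs.exists_isReduced w
  exact (cs.isLeftInversion_of_mem_leftInvSeq hω ((mem_leftInvSeq_iff hω).2 h)).2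

theorem isReduced_of_cons {i : B} {ω : List B} (h : cs.IsReduced (i :: ω)) : cs.IsReduced ω :=
  h.drop 1

theorem simple_mem_leftInvSeq_of_not_isReduced_cons {i : B} {ω : List B} (hω : cs.IsReduced ω)
    (h : ¬cs.IsReduced (i :: ω)) : cs.simple i ∈ cs.leftInvSeq ω := by
  rw [isReduced_iff_nodup_leftInvSeq, CoxeterSystem.leftInvSeq, List.nodup_cons, not_and_or,
    not_not, List.mem_map] at h
  rcases h with ⟨t, ht, hti⟩ | h
  · rw [MulAut.conj_apply, mul_inv_eq_iff_eq_mul, mul_right_inj] at hti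
    rwa [← hti]
  · exact (h (hω.nodup_leftInvSeq.map (MulAut.conj _).injective)).elim

variable (cs) in
theorem exists_sublist_isReduced (ω : List B) :
    ∃ ω', List.Sublist ω' ω ∧ cs.wordProd ω' = cs.wordProd ω ∧ cs.IsReduced ω' := by
  induction ω with
  | nil => exact ⟨[], List.Sublist.refl _, rfl, by simp [CoxeterSystem.IsReduced]⟩
  | cons i ω ih =>
    obtain ⟨ω', hsub, hprod, hred⟩ := ih
    by_cases hi : cs.IsReduced (i :: ω')
    · exact ⟨i :: ω', hsub.cons_cons i, by rw [cs.wordProd_cons, hprod, cs.wordProd_cons], hi⟩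
    obtain ⟨k, hk, hki⟩ :=
      List.getElem_of_mem (simple_mem_leftInvSeq_of_not_isReduced_cons hred hi)
    have herase : cs.wordProd (ω'.eraseIdx k) = cs.wordProd (i :: ω) := by
      rw [← cs.getD_leftInvSeq_mul_wordProd, List.getD_eq_getElem _ _ hk, hki, hprod,
        cs.wordProd_cons]
    refine ⟨ω'.eraseIdx k, ((List.eraseIdx_sublist _ _).trans hsub).cons i, herase, ?_⟩
    have hlength := cs.length_simple_mul (cs.wordProd ω') i
    rw [hred.eq, hprod, ← cs.wordProd_cons, ← herase] at hlength
    have hle := cs.length_wordProd_le (ω'.eraseIdx k)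
    rw [cs.length_leftInvSeq] at hk
    have hlength_erase := List.length_eraseIdx_add_one hk
    rw [CoxeterSystem.IsReduced]
    lia

end StrongExchange

section ParabolicSubgroups

variable {B : Type*} {W : Type u} [Group W] {M : CoxeterMatrix B} (cs : CoxeterSystem M W)

/-- The parabolic subgroup generated by the simple reflections indexed by `T`. -/
def parabolic (T : Set B) : Subgroup W :=
  Subgroup.closure (cs.simple '' T)

/-- The representatives of minimal length of the cosets `W_T e` of the parabolic subgroup `W_T`:
the elements that have no left inversion in `W_T`. -/
def minimalReps (T : Set B) : Set W :=
  {e | ∀ t ∈ parabolic cs T, inversionParity cs e t = 0}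

/-- The reduced words in the letters `T` that represent `w`. -/
def reducedWords (T : Set B) (w : W) : Set (List B) :=
  {ω | cs.IsReduced ω ∧ (∀ i ∈ ω, i ∈ T) ∧ cs.wordProd ω = w}

variable {T : Set B}

theorem simple_mem_parabolic {i : B} (hi : i ∈ T) : cs.simple i ∈ parabolic cs T :=
  Subgroup.subset_closure (Set.mem_image_of_mem _ hi)

theorem parabolic_mono {S : Set B} (h : S ⊆ T) : parabolic cs S ≤ parabolic cs T :=
  Subgroup.closure_mono (Set.image_mono h)

variable {cs}

theorem wordProd_mem_parabolic {ω : List B} (hω : ∀ i ∈ ω, i ∈ T) :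
    cs.wordProd ω ∈ parabolic cs T :=
  Subgroup.list_prod_mem _ <| List.forall_mem_map.2 fun i hi => simple_mem_parabolic cs (hω i hi)

theorem mem_parabolic_of_mem_leftInvSeq {ω : List B} (hω : ∀ i ∈ ω, i ∈ T) {t : W}
    (ht : t ∈ cs.leftInvSeq ω) : t ∈ parabolic cs T := by
  induction ω generalizing t with
  | nil => simp at ht
  | cons i ω ih =>
    obtain ⟨hi, hω⟩ := List.forall_mem_cons.1 hω
    rw [CoxeterSystem.leftInvSeq, List.mem_cons, List.mem_map] at ht
    obtain rfl | ⟨t, ht, rfl⟩ := ht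
    · exact simple_mem_parabolic cs hi
    · exact mul_mem (mul_mem (simple_mem_parabolic cs hi) (ih hω ht))
        (inv_mem (simple_mem_parabolic cs hi))

theorem reducedWords_nonempty {w : W} (hw : w ∈ parabolic cs T) :
    (reducedWords cs T w).Nonempty := by
  suffices ∃ ω : List B, (∀ i ∈ ω, i ∈ T) ∧ cs.wordProd ω = w by
    obtain ⟨ω, hω, rfl⟩ := this
    obtain ⟨ω', hsub, hprod, hred⟩ := exists_sublist_isReduced cs ω
    exact ⟨ω', hred, fun i hi => hω i (hsub.subset hi), hprod⟩
  induction hw using Subgroup.closure_induction with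
  | mem x hx =>
    obtain ⟨i, hi, rfl⟩ := hx
    exact ⟨[i], by simpa using hi, cs.wordProd_singleton i⟩
  | one => exact ⟨[], by simp, cs.wordProd_nil⟩
  | mul x y _ _ hx hy =>
    obtain ⟨ω, hω, rfl⟩ := hx
    obtain ⟨ω', hω', rfl⟩ := hy
    exact ⟨ω ++ ω', List.forall_mem_append.2 ⟨hω, hω'⟩, cs.wordProd_append ω ω'⟩
  | inv x _ hx =>
    obtain ⟨ω, hω, rfl⟩ := hx
    exact ⟨ω.reverse, fun i hi => hω i (List.mem_reverse.1 hi), cs.wordProd_reverse ω⟩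

theorem exists_inversionParity_simple_eq_one {w : W} (hw : w ∈ parabolic cs T) (h1 : w ≠ 1) :
    ∃ j ∈ T, inversionParity cs w (cs.simple j) = 1 := by
  obtain ⟨ω, hred, hω, rfl⟩ := reducedWords_nonempty hw
  cases ω with
  | nil => exact (h1 cs.wordProd_nil).elim
  | cons j ω =>
    exact ⟨j, hω j List.mem_cons_self, (mem_leftInvSeq_iff hred).1 List.mem_cons_self⟩

theorem inversionParity_mul_of_mem_minimalReps {v e t : W} (hv : v ∈ parabolic cs T)
    (he : e ∈ minimalReps cs T) (ht : t ∈ parabolic cs T) :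
    inversionParity cs (v * e) t = inversionParity cs v t := by
  rw [inversionParity_mul, he _ (mul_mem (mul_mem (inv_mem hv) ht) hv), add_zero]

theorem exists_eq_mul_minimalReps (T : Set B) (w : W) :
    ∃ v ∈ parabolic cs T, ∃ e ∈ minimalReps cs T, w = v * e := by
  obtain ⟨v, hv, hmin⟩ := exists_minimalFor_of_wellFoundedLT (· ∈ parabolic cs T)
    (fun v => cs.length (v * w)) ⟨1, one_mem _⟩
  refine ⟨v⁻¹, inv_mem hv, v * w, fun t ht => ?_, (inv_mul_cancel_left v w).symm⟩
  rw [inversionParity_eq_zero_iff]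
  intro h
  have hlt := length_mul_lt_of_inversionParity_eq_one h
  rw [← mul_assoc] at hlt
  exact hlt.not_ge (hmin (mul_mem ht hv) hlt.le)

theorem eq_of_mem_minimalReps {e e' : W} (he : e ∈ minimalReps cs T)
    (he' : e' ∈ minimalReps cs T) (h : e' * e⁻¹ ∈ parabolic cs T) : e' = e := by
  by_contra hne
  obtain ⟨j, hj, hparity⟩ :=
    exists_inversionParity_simple_eq_one h fun h => hne (mul_inv_eq_one.1 h)
  have hj := simple_mem_parabolic cs hj
  rw [← inversionParity_mul_of_mem_minimalReps h he hj, inv_mul_cancel_right, he' _ hj] at hparity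
  exact zero_ne_one hparity

theorem one_mem_minimalReps : (1 : W) ∈ minimalReps cs T := fun t _ => by
  classical
  simpa using inversionParity_wordProd cs [] t

theorem mul_simple_mem_minimalReps {e : W} (he : e ∈ minimalReps cs T) {i : B}
    (h : e * cs.simple i * e⁻¹ ∉ parabolic cs T) : e * cs.simple i ∈ minimalReps cs T := by
  intro t ht
  rw [inversionParity_mul, he t ht, inversionParity_simple, if_neg, add_zero]
  rintro h'
  apply h
  rwa [h', mul_assoc, mul_assoc, mul_inv_cancel, mul_one, mul_inv_cancel_left]

theorem exists_eq_simple_of_mem_parabolic {e : W} (he : e ∈ minimalReps cs T) {i : B}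
    (h : e * cs.simple i * e⁻¹ ∈ parabolic cs T) :
    ∃ j ∈ T, e * cs.simple i * e⁻¹ = cs.simple j := by
  have hne : e * cs.simple i * e⁻¹ ≠ 1 := by
    rw [ne_eq, conj_eq_one_iff]
    intro h
    have := cs.length_simple i
    rw [h, cs.length_one] at this
    exact zero_ne_one this
  obtain ⟨j, hj, hparity⟩ := exists_inversionParity_simple_eq_one h hne
  refine ⟨j, hj, ?_⟩
  have hj := simple_mem_parabolic cs hj
  rw [← inversionParity_mul_of_mem_minimalReps h he hj, inv_mul_cancel_right, inversionParity_mul,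
    he _ hj, zero_add, inversionParity_simple] at hparity
  by_contra hne'
  rw [if_neg] at hparity
  · exact zero_ne_one hparity
  · rintro h
    rw [h] at hne'
    simp [mul_assoc] at hne'

theorem isReduced_append {μ ν : List B} (hμ : cs.IsReduced μ) (hμT : ∀ i ∈ μ, i ∈ T)
    (hν : cs.IsReduced ν) (hmin : cs.wordProd ν ∈ minimalReps cs T) : cs.IsReduced (μ ++ ν) := by
  rw [isReduced_iff_nodup_leftInvSeq, leftInvSeq_append]
  refine hμ.nodup_leftInvSeq.append (hν.nodup_leftInvSeq.map (MulAut.conj _).injective) ?_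
  rintro _ ht h
  obtain ⟨t, htν, rfl⟩ := List.mem_map.1 h
  have htT : t ∈ parabolic cs T := by
    have hμ := wordProd_mem_parabolic (cs := cs) hμT
    have h := mem_parabolic_of_mem_leftInvSeq hμT ht
    rwa [MulAut.conj_apply, Subgroup.mul_mem_cancel_right _ (inv_mem hμ),
      Subgroup.mul_mem_cancel_left _ hμ] at h
  rw [mem_leftInvSeq_iff hν, hmin t htT] at htν
  exact zero_ne_one htν

end ParabolicSubgroups

section Matsumoto

variable {B : Type*} {W : Type u} [Group W] {M : CoxeterMatrix B} {cs : CoxeterSystem M W}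

theorem wordProd_alternatingList_comm (x y : B) :
    cs.wordProd (alternatingList x y (M x y)) = cs.wordProd (alternatingList y x (M x y)) := by
  rw [CoxeterSystem.wordProd, CoxeterSystem.wordProd, prod_map_alternatingList,
    prod_map_alternatingList, alternatingProd_eq_pow_mul (cs.simple_mul_simple_self x)
    (cs.simple_mul_simple_self y), cs.simple_mul_simple_pow, one_mul]

theorem isReduced_alternatingList (x y : B) :
    cs.IsReduced (alternatingList x y (M x y)) := by
  rw [isReduced_iff_nodup_leftInvSeq, leftInvSeq_alternatingList]
  refine List.nodup_range.map_on fun k hk l hl h => ?_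
  rw [List.mem_range, ← orderOf_simple_mul_simple cs] at hk hl
  exact pow_injOn_Iio_orderOf hk hl (mul_right_cancel h)

theorem le_of_isReduced_alternatingList {x y : B} (h0 : M x y ≠ 0) {n : ℕ}
    (h : cs.IsReduced (alternatingList x y n)) : n ≤ M x y := by
  by_contra! hn
  rw [isReduced_iff_nodup_leftInvSeq, leftInvSeq_alternatingList] at h
  exact h0 (List.inj_on_of_nodup_map h (List.mem_range.2 hn)
    (List.mem_range.2 (Nat.zero_lt_of_lt hn)) (by rw [cs.simple_mul_simple_pow, pow_zero]))

theorem eq_alternatingList_of_isReduced {x y : B} {ω : List B}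
    (h : cs.IsReduced (x :: ω)) (hω : ∀ z ∈ ω, z ∈ ({x, y} : Set B)) :
    x :: ω = alternatingList x y (ω.length + 1) := by
  induction ω generalizing x y with
  | nil => rfl
  | cons z ω ih =>
    obtain ⟨hz, hω⟩ := List.forall_mem_cons.1 hω
    have hzx : z ≠ x := by
      rintro rfl
      have := h.nodup_leftInvSeq
      simp [CoxeterSystem.leftInvSeq] at this
    obtain rfl : z = y := hz.resolve_left hzx
    rw [List.length_cons, alternatingList,
      ← ih (isReduced_of_cons h) (Set.pair_comm x z ▸ hω)]

theorem eq_length_of_simple_mem_leftInvSeq_alternatingList {x y : B} {n : ℕ}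
    (h : cs.IsReduced (alternatingList x y n))
    (hy : cs.simple y ∈ cs.leftInvSeq (alternatingList x y n)) : M x y ≠ 0 ∧ n = M x y := by
  rw [leftInvSeq_alternatingList, List.mem_map] at hy
  obtain ⟨k, hk, hky⟩ := hy
  have hdvd : M x y ∣ k + 1 := by
    rw [← orderOf_simple_mul_simple cs, orderOf_dvd_iff_pow_eq_one, pow_succ, ← mul_assoc, hky,
      cs.simple_mul_simple_self]
  have h0 : M x y ≠ 0 := fun h0 => k.succ_ne_zero (Nat.eq_zero_of_zero_dvd (h0 ▸ hdvd))
  have hle := Nat.le_of_dvd k.succ_pos hdvd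
  have := le_of_isReduced_alternatingList h0 h
  rw [List.mem_range] at hk
  exact ⟨h0, by lia⟩

theorem eq_wordProd_alternatingList_of_inversionParity {x y : B} {v : W}
    (hv : v ∈ parabolic cs {x, y}) (hx : inversionParity cs v (cs.simple x) = 1)
    (hy : inversionParity cs v (cs.simple y) = 1) :
    M x y ≠ 0 ∧ v = cs.wordProd (alternatingList x y (M x y)) := by
  obtain ⟨ω, hred, hω, rfl⟩ := reducedWords_nonempty hv
  rw [← mem_leftInvSeq_iff hred] at hx hy
  cases ω with
  | nil => simp at hx
  | cons z ω =>
    obtain ⟨rfl | rfl, hω⟩ := List.forall_mem_cons.1 hω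
    · have halt := eq_alternatingList_of_isReduced hred hω
      rw [halt] at hred hy ⊢
      obtain ⟨h0, h⟩ := eq_length_of_simple_mem_leftInvSeq_alternatingList hred hy
      exact ⟨h0, by rw [h]⟩
    · have halt := eq_alternatingList_of_isReduced hred (Set.pair_comm x z ▸ hω)
      rw [halt] at hred hx ⊢
      obtain ⟨h0, h⟩ := eq_length_of_simple_mem_leftInvSeq_alternatingList hred hx
      rw [M.symmetric] at h0 h
      exact ⟨h0, by rw [h, wordProd_alternatingList_comm]⟩

theorem alternatingList_append_mem_reducedWords {T : Set B} {x y : B} (hx : x ∈ T) (hy : y ∈ T)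
    {ν : List B} {e : W} (hν : ν ∈ reducedWords cs T e) (he : e ∈ minimalReps cs {x, y}) :
    alternatingList x y (M x y) ++ ν ∈
      reducedWords cs T (cs.wordProd (alternatingList x y (M x y)) * e) := by
  obtain ⟨hred, hνT, rfl⟩ := hν
  refine ⟨isReduced_append (isReduced_alternatingList x y)
    (fun _ => mem_pair_of_mem_alternatingList) hred he, ?_, cs.wordProd_append _ _⟩
  exact List.forall_mem_append.2
    ⟨fun i hi => Set.pair_subset hx hy (mem_pair_of_mem_alternatingList hi), hνT⟩

theorem exists_alternatingList_append_mem_reducedWords {T : Set B} {x y : B} (hx : x ∈ T)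
    (hy : y ∈ T) {w : W} (hw : w ∈ parabolic cs T) (hwx : inversionParity cs w (cs.simple x) = 1)
    (hwy : inversionParity cs w (cs.simple y) = 1) :
    M x y ≠ 0 ∧ ∃ ν : List B, alternatingList x y (M x y) ++ ν ∈ reducedWords cs T w ∧
      alternatingList y x (M x y) ++ ν ∈ reducedWords cs T w := by
  obtain ⟨v, hv, e, he, rfl⟩ := exists_eq_mul_minimalReps (cs := cs) {x, y} w
  rw [inversionParity_mul_of_mem_minimalReps hv he (simple_mem_parabolic cs (by simp))]
    at hwx hwy
  obtain ⟨h0, rfl⟩ := eq_wordProd_alternatingList_of_inversionParity hv hwx hwy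
  have heT : e ∈ parabolic cs T :=
    (Subgroup.mul_mem_cancel_left _ (parabolic_mono cs (Set.pair_subset hx hy) hv)).1 hw
  obtain ⟨ν, hν⟩ := reducedWords_nonempty heT
  refine ⟨h0, ν, alternatingList_append_mem_reducedWords hx hy hν he, ?_⟩
  rw [wordProd_alternatingList_comm, M.symmetric x y]
  exact alternatingList_append_mem_reducedWords hy hx hν (Set.pair_comm x y ▸ he)

theorem length_of_mem_reducedWords {T : Set B} {ω : List B} {w : W}
    (h : ω ∈ reducedWords cs T w) : ω.length = cs.length w := by
  obtain ⟨hred, -, rfl⟩ := h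
  exact hred.eq.symm

theorem mem_reducedWords_of_cons {T : Set B} {i : B} {ω : List B} {w : W}
    (h : i :: ω ∈ reducedWords cs T w) : ω ∈ reducedWords cs T (cs.simple i * w) := by
  obtain ⟨hred, hT, rfl⟩ := h
  exact ⟨isReduced_of_cons hred, (List.forall_mem_cons.1 hT).2, by simp [cs.wordProd_cons]⟩

theorem inversionParity_of_cons_mem_reducedWords {T : Set B} {i : B} {ω : List B} {w : W}
    (h : i :: ω ∈ reducedWords cs T w) : inversionParity cs w (cs.simple i) = 1 := by
  obtain ⟨hred, -, rfl⟩ := h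
  exact (mem_leftInvSeq_iff hred).1 List.mem_cons_self

/-- Matsumoto's theorem, for the words in a set `T` of letters. -/
theorem prod_map_eq_of_mem_reducedWords {K : Type v} [Group K] {T : Set B} {κ : B → K}
    (hκ : ∀ p ∈ T, ∀ q ∈ T, p ≠ q → M p q ≠ 0 →
      alternatingProd (κ p) (κ q) (M p q) = alternatingProd (κ q) (κ p) (M p q))
    {w : W} {ω ω' : List B} (hω : ω ∈ reducedWords cs T w) (hω' : ω' ∈ reducedWords cs T w) :
    (ω.map κ).prod = (ω'.map κ).prod := by
  induction hn : cs.length w using Nat.strong_induction_on generalizing w ω ω' with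
  | _ n ih =>
    subst hn
    have hcons (r : B) (μ μ' : List B) (hμ : r :: μ ∈ reducedWords cs T w)
        (hμ' : r :: μ' ∈ reducedWords cs T w) :
        ((r :: μ).map κ).prod = ((r :: μ').map κ).prod := by
      have hlt :=
        length_mul_lt_of_inversionParity_eq_one (inversionParity_of_cons_mem_reducedWords hμ)
      rw [List.map_cons, List.map_cons, List.prod_cons, List.prod_cons,
        ih _ hlt (mem_reducedWords_of_cons hμ) (mem_reducedWords_of_cons hμ') rfl]
    match ω, ω', hω, hω' with
    | [], ω', hω, hω' =>
      rw [List.length_eq_zero_iff.1 ((length_of_mem_reducedWords hω').trans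
        (length_of_mem_reducedWords hω).symm)]
    | ω, [], hω, hω' =>
      rw [List.length_eq_zero_iff.1 ((length_of_mem_reducedWords hω).trans
        (length_of_mem_reducedWords hω').symm)]
    | p :: ω, q :: ω', hω, hω' =>
      have hw : w ∈ parabolic cs T := hω.2.2 ▸ wordProd_mem_parabolic hω.2.1
      rcases eq_or_ne p q with rfl | hpq
      · exact hcons p ω ω' hω hω'
      have hp := hω.2.1 p List.mem_cons_self
      have hq := hω'.2.1 q List.mem_cons_self
      obtain ⟨h0, ν, hν, hν'⟩ := exists_alternatingList_append_mem_reducedWords hp hq hw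
        (inversionParity_of_cons_mem_reducedWords hω) (inversionParity_of_cons_mem_reducedWords hω')
      obtain ⟨m, hm⟩ := Nat.exists_eq_succ_of_ne_zero h0
      have hbraid := hκ p hp q hq hpq h0
      rw [← prod_map_alternatingList, ← prod_map_alternatingList] at hbraid
      rw [hm] at hν hν' hbraid
      calc ((p :: ω).map κ).prod = ((alternatingList p q (m + 1) ++ ν).map κ).prod :=
            hcons p ω _ hω hν
        _ = ((alternatingList q p (m + 1) ++ ν).map κ).prod := by
            rw [List.map_append, List.map_append, List.prod_append, List.prod_append, hbraid]
        _ = ((q :: ω').map κ).prod := hcons q _ ω' hν' hω'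

end Matsumoto

section WreathProduct

variable {A : Type*} {G : Type*} {K : Type*} {Q : Type*} [Group A] [Group G] [Group K]
  [MulAction G Q]

theorem mulAutArrow_apply_eq (g : G) (f : Q → K) (y : Q) : mulAutArrow g f y = f (g⁻¹ • y) :=
  rfl

/-- The homomorphism to `K` obtained from a homomorphism to the wreath product of `K` and `G` over
`Q` by evaluating the first component at a point fixed by the second components. -/
def leftAtFixedPoint (ψ : A →* (Q → K) ⋊[mulAutArrow] G) (y : Q)
    (hy : ∀ a, (ψ a).right • y = y) : A →* K where
  toFun a := (ψ a).left y
  map_one' := by rw [map_one]; rfl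
  map_mul' a b := by
    rw [map_mul, SemidirectProduct.mul_left, Pi.mul_apply, mulAutArrow_apply_eq,
      inv_smul_eq_iff.2 (hy a).symm]

end WreathProduct

section CosetCocycle

variable {B : Type*} {W : Type u} [Group W] {M : CoxeterMatrix B} (cs : CoxeterSystem M W)
  (T : Set B)

theorem exists_mk_eq_and_inv_mem_minimalReps (y : W ⧸ parabolic cs T) :
    ∃ d : W, (d : W ⧸ parabolic cs T) = y ∧ d⁻¹ ∈ minimalReps cs T := by
  induction y using QuotientGroup.induction_on with
  | H w =>
    obtain ⟨v, hv, e, he, h⟩ := exists_eq_mul_minimalReps (cs := cs) T w⁻¹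
    refine ⟨e⁻¹, QuotientGroup.eq.2 ?_, by rwa [inv_inv]⟩
    rw [← inv_mem_iff, mul_inv_rev, h]
    simpa using hv

/-- The representative of minimal length of a coset `w W_T`. -/
noncomputable def cosetRep (y : W ⧸ parabolic cs T) : W :=
  (exists_mk_eq_and_inv_mem_minimalReps cs T y).choose

variable {cs T}

theorem mk_cosetRep (y : W ⧸ parabolic cs T) : QuotientGroup.mk (cosetRep cs T y) = y :=
  (exists_mk_eq_and_inv_mem_minimalReps cs T y).choose_spec.1

theorem cosetRep_inv_mem_minimalReps (y : W ⧸ parabolic cs T) :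
    (cosetRep cs T y)⁻¹ ∈ minimalReps cs T :=
  (exists_mk_eq_and_inv_mem_minimalReps cs T y).choose_spec.2

theorem cosetRep_mk {d : W} (hd : d⁻¹ ∈ minimalReps cs T) : cosetRep cs T d = d := by
  refine inv_injective (eq_of_mem_minimalReps hd (cosetRep_inv_mem_minimalReps _) ?_)
  rw [inv_inv]
  exact QuotientGroup.eq.1 (mk_cosetRep _)

theorem cosetRep_simple_smul {i : B} {y : W ⧸ parabolic cs T} (h : cs.simple i • y ≠ y) :
    cosetRep cs T (cs.simple i • y) = cs.simple i * cosetRep cs T y := by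
  have hmk : cs.simple i • y = ((cs.simple i * cosetRep cs T y : W) : W ⧸ parabolic cs T) := by
    conv_lhs => rw [← mk_cosetRep y]
    rfl
  rw [hmk] at h ⊢
  refine cosetRep_mk ?_
  rw [mul_inv_rev, cs.inv_simple]
  refine mul_simple_mem_minimalReps (cosetRep_inv_mem_minimalReps y) fun hmem => h ?_
  conv_rhs => rw [← mk_cosetRep y]
  rw [QuotientGroup.eq, ← inv_mem_iff]
  simpa [mul_assoc] using hmem

theorem exists_conj_cosetRep_eq_simple {i : B} {y : W ⧸ parabolic cs T}
    (h : cs.simple i • y = y) :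
    ∃ j ∈ T, (cosetRep cs T y)⁻¹ * cs.simple i * cosetRep cs T y = cs.simple j := by
  have hmem : (cosetRep cs T y)⁻¹ * cs.simple i * (cosetRep cs T y)⁻¹⁻¹ ∈ parabolic cs T := by
    rw [inv_inv, mul_assoc, ← QuotientGroup.eq, mk_cosetRep]
    nth_rw 1 [← h, ← mk_cosetRep y]
    rfl
  simpa only [inv_inv] using
    exists_eq_simple_of_mem_parabolic (cosetRep_inv_mem_minimalReps y) hmem

open Classical in
variable (cs T) in
/-- The word with at most one letter that an edge from the coset `y` to `s i • y` of the Schreier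
graph contributes to a word in `T`: a loop contributes the letter `j` for which `s j` is the
conjugate of `s i` by the representative of `y`. -/
noncomputable def edgeWord (i : B) (y : W ⧸ parabolic cs T) : List B :=
  if h : cs.simple i • y = y then [(exists_conj_cosetRep_eq_simple h).choose] else []

variable (cs T) in
/-- The word in the letters `T` contributed by the path that starts at the coset `y` and reads the
word `ω` in the Schreier graph. -/
noncomputable def pathWord : List B → W ⧸ parabolic cs T → List B
  | [], _ => []
  | i :: ω, y => edgeWord cs T i y ++ pathWord ω (cs.simple i • y)

theorem mem_of_mem_edgeWord {i j : B} {y : W ⧸ parabolic cs T} (hj : j ∈ edgeWord cs T i y) :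
    j ∈ T := by
  rw [edgeWord] at hj
  split_ifs at hj with h
  · rw [List.mem_singleton.1 hj]
    exact (exists_conj_cosetRep_eq_simple h).choose_spec.1
  · cases hj

theorem mem_of_mem_pathWord {ω : List B} {y : W ⧸ parabolic cs T} :
    ∀ j ∈ pathWord cs T ω y, j ∈ T := by
  induction ω generalizing y with
  | nil => exact fun _ h => nomatch h
  | cons i ω ih => exact List.forall_mem_append.2 ⟨fun _ => mem_of_mem_edgeWord, ih⟩

theorem wordProd_edgeWord (i : B) (y : W ⧸ parabolic cs T) :
    cs.wordProd (edgeWord cs T i y) =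
      (cosetRep cs T y)⁻¹ * cs.simple i * cosetRep cs T (cs.simple i • y) := by
  rw [edgeWord]
  split_ifs with h
  · rw [cs.wordProd_singleton, ← (exists_conj_cosetRep_eq_simple h).choose_spec.2, h]
  · rw [cosetRep_simple_smul h]
    simp [mul_assoc]

theorem wordProd_pathWord (ω : List B) (y : W ⧸ parabolic cs T) :
    cs.wordProd (pathWord cs T ω y) =
      (cosetRep cs T y)⁻¹ * cs.wordProd ω * cosetRep cs T ((cs.wordProd ω)⁻¹ • y) := by
  induction ω generalizing y with
  | nil => simp [pathWord]
  | cons i ω ih =>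
    rw [pathWord, cs.wordProd_append, wordProd_edgeWord, ih, cs.wordProd_cons, mul_inv_rev,
      cs.inv_simple, mul_smul]
    group

theorem leftInvSeq_edgeWord_sublist (i : B) (y : W ⧸ parabolic cs T) :
    List.Sublist (cs.leftInvSeq (edgeWord cs T i y))
      [(cosetRep cs T y)⁻¹ * cs.simple i * cosetRep cs T y] := by
  rw [edgeWord]
  split_ifs with h
  · rw [cs.leftInvSeq_singleton, ← (exists_conj_cosetRep_eq_simple h).choose_spec.2]
  · exact List.nil_sublist _

theorem leftInvSeq_pathWord_sublist (ω : List B) (y : W ⧸ parabolic cs T) :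
    List.Sublist (cs.leftInvSeq (pathWord cs T ω y))
      ((cs.leftInvSeq ω).map (MulAut.conj (cosetRep cs T y)⁻¹)) := by
  induction ω generalizing y with
  | nil => exact List.nil_sublist _
  | cons i ω ih =>
    have hconj : MulAut.conj (cs.wordProd (edgeWord cs T i y)) *
        MulAut.conj (cosetRep cs T (cs.simple i • y))⁻¹ =
        MulAut.conj (cosetRep cs T y)⁻¹ * MulAut.conj (cs.simple i) := by
      rw [← map_mul, ← map_mul, wordProd_edgeWord, mul_inv_cancel_right]
    rw [pathWord, leftInvSeq_append, CoxeterSystem.leftInvSeq, List.map_cons, List.map_map,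
      ← MulAut.coe_mul, ← hconj, MulAut.coe_mul, ← List.map_map, MulAut.conj_apply, inv_inv,
      ← List.singleton_append]
    exact (leftInvSeq_edgeWord_sublist i y).append ((ih _).map _)

theorem isReduced_pathWord {ω : List B} (hω : cs.IsReduced ω) (y : W ⧸ parabolic cs T) :
    cs.IsReduced (pathWord cs T ω y) :=
  isReduced_iff_nodup_leftInvSeq.2 <| (leftInvSeq_pathWord_sublist ω y).nodup <|
    hω.nodup_leftInvSeq.map (MulAut.conj _).injective

theorem pathWord_mem_reducedWords {ω : List B} (hω : cs.IsReduced ω) (y : W ⧸ parabolic cs T) :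
    pathWord cs T ω y ∈ reducedWords cs T
      ((cosetRep cs T y)⁻¹ * cs.wordProd ω * cosetRep cs T ((cs.wordProd ω)⁻¹ • y)) :=
  ⟨isReduced_pathWord hω y, mem_of_mem_pathWord, wordProd_pathWord ω y⟩

theorem edgeWord_base {i : B} (hi : i ∈ T) :
    edgeWord cs T i ((1 : W) : W ⧸ parabolic cs T) = [i] := by
  have hrep : cosetRep cs T ((1 : W) : W ⧸ parabolic cs T) = 1 :=
    cosetRep_mk (by rw [inv_one]; exact one_mem_minimalReps)
  have hfix : cs.simple i • ((1 : W) : W ⧸ parabolic cs T) = ((1 : W) : W ⧸ parabolic cs T) :=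
    QuotientGroup.eq.2 (by simpa using simple_mem_parabolic cs hi)
  have hconj : ∀ w : W, w = 1 → w⁻¹ * cs.simple i * w = cs.simple i := by
    rintro _ rfl
    simp
  rw [edgeWord, dif_pos hfix]
  exact congrArg (fun j => [j]) <| simple_injective cs <|
    (exists_conj_cosetRep_eq_simple hfix).choose_spec.2.symm.trans (hconj _ hrep)

variable {K : Type v} [Group K]

variable (cs T) in
/-- The element of the wreath product of `K` and `W` over the cosets of `W_T` with second component
`s i` whose first component reads the edges labelled `i` of the Schreier graph through `κ`. -/
noncomputable def wreathGenerator (κ : B → K) (i : B) :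
    (W ⧸ parabolic cs T → K) ⋊[mulAutArrow] W :=
  ⟨fun y => ((edgeWord cs T i y).map κ).prod, cs.simple i⟩

theorem prod_map_wreathGenerator (κ : B → K) (ω : List B) :
    (ω.map (wreathGenerator cs T κ)).prod =
      ⟨fun y => ((pathWord cs T ω y).map κ).prod, cs.wordProd ω⟩ := by
  induction ω with
  | nil => rfl
  | cons i ω ih =>
    rw [List.map_cons, List.prod_cons, ih]
    refine SemidirectProduct.ext (funext fun y => ?_) (cs.wordProd_cons i ω).symm
    simp only [wreathGenerator, pathWord, List.map_append, List.prod_append,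
      SemidirectProduct.mul_left, Pi.mul_apply]
    rw [mulAutArrow_apply_eq, cs.inv_simple]

theorem alternatingProd_wreathGenerator_comm {κ : B → K}
    (hκ : ∀ p ∈ T, ∀ q ∈ T, p ≠ q → M p q ≠ 0 →
      alternatingProd (κ p) (κ q) (M p q) = alternatingProd (κ q) (κ p) (M p q)) (x y : B) :
    alternatingProd (wreathGenerator cs T κ x) (wreathGenerator cs T κ y) (M x y) =
      alternatingProd (wreathGenerator cs T κ y) (wreathGenerator cs T κ x) (M x y) := by
  have hprod := wordProd_alternatingList_comm (cs := cs) x y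
  have hred := M.symmetric y x ▸ isReduced_alternatingList (cs := cs) y x
  rw [← prod_map_alternatingList, ← prod_map_alternatingList, prod_map_wreathGenerator,
    prod_map_wreathGenerator]
  refine SemidirectProduct.ext (funext fun z => ?_) hprod
  refine prod_map_eq_of_mem_reducedWords hκ
    (pathWord_mem_reducedWords (isReduced_alternatingList x y) z) ?_
  rw [hprod]
  exact pathWord_mem_reducedWords hred z

end CosetCocycle

namespace LabelledGraph

variable {V : Type u} {W : Type v}

theorem alternatingProd_of_comm (Γ : LabelledGraph V) {x y : V} (h : Γ.graph.Adj x y) :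
    alternatingProd (PresentedGroup.of (rels := Γ.artinRelators) x) (PresentedGroup.of y)
        (Γ.label.get x y h) =
      alternatingProd (PresentedGroup.of y) (PresentedGroup.of x) (Γ.label.get x y h) := by
  have hrel : PresentedGroup.mk Γ.artinRelators _ = 1 :=
    PresentedGroup.one_of_mem ⟨x, y, h, rfl⟩
  rw [map_mul, map_inv, map_alternatingProd, map_alternatingProd, mul_inv_eq_one] at hrel
  exact hrel

/-- The homomorphism from the Artin group defined by a family of elements satisfying the braid
relations. -/
def artinLift (Γ : LabelledGraph V) {G : Type v} [Group G] (f : V → G)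
    (hf : ∀ (x y : V) (h : Γ.graph.Adj x y), alternatingProd (f x) (f y) (Γ.label.get x y h) =
      alternatingProd (f y) (f x) (Γ.label.get x y h)) : Γ.ArtinGroup →* G :=
  PresentedGroup.toGroup (f := f) (by
    rintro r ⟨x, y, h, rfl⟩
    rw [map_mul, map_inv, map_alternatingProd, map_alternatingProd, mul_inv_eq_one]
    simpa only [FreeGroup.lift_apply_of] using hf x y h)

theorem artinLift_of (Γ : LabelledGraph V) {G : Type v} [Group G] (f : V → G)
    (hf : ∀ (x y : V) (h : Γ.graph.Adj x y), alternatingProd (f x) (f y) (Γ.label.get x y h) =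
      alternatingProd (f y) (f x) (Γ.label.get x y h)) (x : V) :
    Γ.artinLift f hf (PresentedGroup.of x) = f x :=
  PresentedGroup.toGroup.of _

open Classical in
/-- The Coxeter matrix of a labelled graph. As in Mathlib, the entry `0` stands for `∞`; it marks
the pairs of distinct vertices not joined by an edge. -/
noncomputable def coxeterMatrix (Γ : LabelledGraph V) : CoxeterMatrix V where
  M := Matrix.of fun x y =>
    if x = y then 1 else if h : Γ.graph.Adj x y then Γ.label.get x y h else 0
  isSymm := by
    ext x y
    simp only [Matrix.transpose_apply, Matrix.of_apply, eq_comm (a := x), Γ.graph.adj_comm x y]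
    congr 1
    split_ifs with h
    · exact Γ.label.get_comm _ _ _
    · rfl
  diagonal x := by simp
  off_diagonal x y hxy := by
    simp only [Matrix.of_apply, if_neg hxy]
    split_ifs with h
    · exact (one_lt_two.trans_le (Γ.two_le_label ⟨s(x, y), h⟩)).ne'
    · exact zero_ne_one

theorem coxeterMatrix_of_adj (Γ : LabelledGraph V) {x y : V} (h : Γ.graph.Adj x y) :
    Γ.coxeterMatrix x y = Γ.label.get x y h := by
  simp [coxeterMatrix, h, h.ne]

theorem adj_of_coxeterMatrix_ne_zero (Γ : LabelledGraph V) {x y : V} (hxy : x ≠ y)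
    (h : Γ.coxeterMatrix x y ≠ 0) : Γ.graph.Adj x y := by
  by_contra h'
  simp [coxeterMatrix, h', hxy] at h

namespace Inclusion

variable {Γ₁ : LabelledGraph V} {Γ₂ : LabelledGraph W} (i : Inclusion Γ₁ Γ₂)

/-- The generators of `Γ₁.ArtinGroup` indexed by the vertices of `Γ₂`, with value `1` outside of
the image of `i`. -/
noncomputable def extendedGenerator : W → Γ₁.ArtinGroup :=
  Function.extend i.toFun PresentedGroup.of 1

theorem extendedGenerator_apply (x : V) :
    i.extendedGenerator (i.toFun x) = PresentedGroup.of x :=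
  i.injective.extend_apply _ _ x

variable (hfull : ∀ x y, Γ₂.graph.Adj (i.toFun x) (i.toFun y) → Γ₁.graph.Adj x y)

include hfull in
theorem alternatingProd_extendedGenerator_comm :
    ∀ p ∈ Set.range i.toFun, ∀ q ∈ Set.range i.toFun, p ≠ q → Γ₂.coxeterMatrix p q ≠ 0 →
      alternatingProd (i.extendedGenerator p) (i.extendedGenerator q) (Γ₂.coxeterMatrix p q) =
        alternatingProd (i.extendedGenerator q) (i.extendedGenerator p)
          (Γ₂.coxeterMatrix p q) := by
  rintro _ ⟨x, rfl⟩ _ ⟨y, rfl⟩ hne h0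
  have h₂ := Γ₂.adj_of_coxeterMatrix_ne_zero hne h0
  have h₁ := hfull x y h₂
  rw [Γ₂.coxeterMatrix_of_adj h₂, i.map_label h₁, extendedGenerator_apply,
    extendedGenerator_apply, Γ₁.alternatingProd_of_comm]

/-- The homomorphism from the Artin group of `Γ₂` to the wreath product of the Artin group of a
full subgraph `Γ₁` and the Coxeter group of `Γ₂` over the cosets of the parabolic subgroup
of `Γ₁`. -/
noncomputable def artinToWreath : Γ₂.ArtinGroup →*
    (Γ₂.coxeterMatrix.Group ⧸
      parabolic Γ₂.coxeterMatrix.toCoxeterSystem (Set.range i.toFun) → Γ₁.ArtinGroup)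
        ⋊[mulAutArrow] Γ₂.coxeterMatrix.Group :=
  Γ₂.artinLift (wreathGenerator Γ₂.coxeterMatrix.toCoxeterSystem _ i.extendedGenerator)
    fun x y h => by
      rw [← Γ₂.coxeterMatrix_of_adj h]
      exact alternatingProd_wreathGenerator_comm
        (i.alternatingProd_extendedGenerator_comm hfull) x y

theorem artinToWreath_artinMap_of (x : V) :
    i.artinToWreath hfull (i.artinMap (PresentedGroup.of x)) =
      wreathGenerator Γ₂.coxeterMatrix.toCoxeterSystem (Set.range i.toFun) i.extendedGenerator
        (i.toFun x) := by
  rw [artinMap_of, artinToWreath, artinLift_of]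

theorem right_artinToWreath_artinMap_mem (a : Γ₁.ArtinGroup) :
    (i.artinToWreath hfull (i.artinMap a)).right ∈
      parabolic Γ₂.coxeterMatrix.toCoxeterSystem (Set.range i.toFun) := by
  have hle : Subgroup.closure (Set.range PresentedGroup.of) ≤
      (parabolic Γ₂.coxeterMatrix.toCoxeterSystem (Set.range i.toFun)).comap
        (SemidirectProduct.rightHom.comp ((i.artinToWreath hfull).comp i.artinMap)) := by
    rw [Subgroup.closure_le]
    rintro _ ⟨x, rfl⟩
    change (i.artinToWreath hfull (i.artinMap (PresentedGroup.of x))).right ∈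
      parabolic Γ₂.coxeterMatrix.toCoxeterSystem (Set.range i.toFun)
    rw [artinToWreath_artinMap_of]
    exact simple_mem_parabolic _ (Set.mem_range_self x)
  rw [PresentedGroup.closure_range_of] at hle
  exact hle (Subgroup.mem_top a)

include hfull in
theorem artinMap_injective : Function.Injective i.artinMap := by
  let cs := Γ₂.coxeterMatrix.toCoxeterSystem
  let T : Set W := Set.range i.toFun
  let base : Γ₂.coxeterMatrix.Group ⧸ parabolic cs T := QuotientGroup.mk 1
  have hbase : ∀ a, (i.artinToWreath hfull (i.artinMap a)).right • base = base := fun a =>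
    QuotientGroup.eq.2 (by simpa using i.right_artinToWreath_artinMap_mem hfull a)
  have hid : leftAtFixedPoint ((i.artinToWreath hfull).comp i.artinMap) base hbase =
      MonoidHom.id _ := by
    refine PresentedGroup.ext fun x => ?_
    change (i.artinToWreath hfull (i.artinMap (PresentedGroup.of x))).left base =
      PresentedGroup.of x
    rw [artinToWreath_artinMap_of]
    change ((edgeWord cs T (i.toFun x) base).map i.extendedGenerator).prod = _
    rw [edgeWord_base (Set.mem_range_self x), List.map_singleton, List.prod_singleton,
      extendedGenerator_apply]
  intro a b hab
  have hleft : leftAtFixedPoint ((i.artinToWreath hfull).comp i.artinMap) base hbase a =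
      leftAtFixedPoint ((i.artinToWreath hfull).comp i.artinMap) base hbase b :=
    congrArg (fun g => (i.artinToWreath hfull g).left base) hab
  rwa [hid] at hleft

end Inclusion

end LabelledGraph

section FreeGroups

variable {G : Type*} {H : Type*} [Group G] [Group H]

theorem isFreeGroup_of_injective [IsFreeGroup H] (f : G →* H) (hf : Function.Injective f) :
    IsFreeGroup G :=
  ((IsFreeGroup.basis f.range).map (MonoidHom.ofInjective hf).symm).isFreeGroup

theorem isFreeGroup_ker_of_injective {f : G →* H} (hf : Function.Injective f) :
    IsFreeGroup f.ker :=
  isFreeGroup_of_injective (1 : f.ker →* FreeGroup Empty) fun x y _ =>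
    Subtype.ext (hf (x.2.trans y.2.symm))

theorem isFreeGroup_ker_of_comp_mulEquiv {K : Type*} [Group K] (f : G →* H) (e : K ≃* G)
    [IsFreeGroup (f.comp e.toMonoidHom).ker] : IsFreeGroup f.ker :=
  isFreeGroup_of_injective
    ((e.symm.toMonoidHom.comp f.ker.subtype).codRestrict (f.comp e.toMonoidHom).ker
      fun x => (congrArg f (e.apply_symm_apply x)).trans x.2)
    fun _ _ hxy => Subtype.ext (e.symm.injective (congrArg Subtype.val hxy))

end FreeGroups

section ActionsOfAmalgams

theorem exists_equivariant_of_free {G Q : Type*} [Group G] [MulAction G Q] (R : Subgroup G)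
    (hR : ∀ r ∈ R, ∀ q : Q, r • q = q → r = 1) :
    ∃ p : Q → G, ∀ r ∈ R, ∀ q, p (r • q) = r * p q := by
  let rep : Q → Q := fun q => Quotient.out (Quotient.mk (MulAction.orbitRel R Q) q)
  have hrep : ∀ q, ∃ r ∈ R, r • rep q = q := fun q => by
    obtain ⟨r, hr⟩ := MulAction.orbitRel_apply.1 (Quotient.mk_out (s := MulAction.orbitRel R Q) q)
    exact ⟨r⁻¹, inv_mem r.2, inv_smul_eq_iff.2 hr.symm⟩
  choose p hpR hp using hrep
  refine ⟨p, fun r hr q => ?_⟩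
  have hrep_smul : rep (r • q) = rep q :=
    congrArg Quotient.out (Quotient.sound ⟨⟨r, hr⟩, rfl⟩)
  rw [← inv_mul_eq_one]
  refine hR _ (mul_mem (inv_mem (hpR _)) (mul_mem hr (hpR q))) (rep q) ?_
  rw [mul_smul, mul_smul, hp, inv_smul_eq_iff, ← hrep_smul, hp]

variable {ι : Type*} {H : Type*} {K : ι → Type*} [Group H] [∀ i, Group (K i)]
  {φ : ∀ i, H →* K i} {Q : Type*} [MulAction (Monoid.PushoutI φ) Q] {F : Type*} [Group F]

open Monoid.PushoutI SemidirectProduct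

/-- The homomorphism from `K i` to the wreath product of `F` and the amalgam over `Q` whose first
component is the coboundary of `q`. -/
def coboundaryHom (q : Q → F) (i : ι) : K i →* (Q → F) ⋊[mulAutArrow] Monoid.PushoutI φ :=
  (MulAut.conj (inl q)).toMonoidHom.comp (inr.comp (of i))

theorem left_coboundaryHom (q : Q → F) (i : ι) (s : K i) (y : Q) :
    (coboundaryHom (φ := φ) q i s).left y = q y * (q ((of (φ := φ) i s)⁻¹ • y))⁻¹ := by
  change ((inl q * inr (of i s) * (inl q)⁻¹ :
    (Q → F) ⋊[mulAutArrow] Monoid.PushoutI φ)).left y = _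
  rw [← map_inv, mul_left, mul_left]
  simp only [left_inl, left_inr, right_inl, right_inr, mul_right, map_one, one_mul, mul_one,
    Pi.mul_apply, mulAutArrow_apply_eq, Pi.inv_apply]

theorem right_coboundaryHom (q : Q → F) (i : ι) (s : K i) :
    (coboundaryHom (φ := φ) q i s).right = of i s := by
  simp [coboundaryHom]

theorem coboundaryHom_apply_eq (q : ι → Q → F)
    (hq : ∀ i j (b : H) y, (q i (base φ b • y))⁻¹ * q j (base φ b • y) = (q i y)⁻¹ * q j y)
    (i j : ι) (b : H) :
    coboundaryHom (φ := φ) (q i) i (φ i b) = coboundaryHom (q j) j (φ j b) := by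
  refine SemidirectProduct.ext (funext fun y => ?_) ?_
  · rw [left_coboundaryHom, left_coboundaryHom, of_apply_eq_base, of_apply_eq_base]
    have h := hq i j b⁻¹ y
    rw [map_inv] at h
    rw [eq_mul_inv_iff_mul_eq, mul_assoc, h, mul_inv_cancel_left]
  · rw [right_coboundaryHom, right_coboundaryHom, of_apply_eq_base, of_apply_eq_base]

theorem exists_lift_potentials [Nonempty ι] {π : F →* Monoid.PushoutI φ}
    (hπ : Function.Surjective π)
    (hfree : ∀ i (s : K i) (y : Q), of (φ := φ) i s • y = y → of (φ := φ) i s = 1) :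
    ∃ q : ι → Q → F,
      (∀ i (s : K i) y, π (q i (of (φ := φ) i s • y)) = of i s * π (q i y)) ∧
      ∀ i j (b : H) y, (q i (base φ b • y))⁻¹ * q j (base φ b • y) = (q i y)⁻¹ * q j y := by
  obtain ⟨σ, hσ⟩ := hπ.hasRightInverse
  have hp : ∀ i, ∃ p : Q → Monoid.PushoutI φ, ∀ (s : K i) (y : Q),
      p (of (φ := φ) i s • y) = of i s * p y := by
    intro i
    obtain ⟨p, hp⟩ := exists_equivariant_of_free (Q := Q) (of (φ := φ) i).range
      (by rintro _ ⟨s, rfl⟩; exact hfree i s)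
    exact ⟨p, fun s => hp _ ⟨s, rfl⟩⟩
  choose p hp using hp
  let i₀ : ι := Classical.arbitrary ι
  have hpbase : ∀ i (b : H) y, p i (base φ b • y) = base φ b * p i y := fun i b y => by
    rw [← of_apply_eq_base φ i, hp]
  -- The base group leaves `(p i₀)⁻¹ * p i` invariant, so the section `σ` may be applied to it.
  refine ⟨fun i y => σ (p i₀ y) * σ ((p i₀ y)⁻¹ * p i y), fun i s y => ?_, fun i j b y => ?_⟩
  · simp only [map_mul, hσ _, mul_inv_cancel_left, hp]
  · simp only [hpbase, mul_inv_rev, mul_assoc, inv_mul_cancel_left]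

theorem exists_wreathLift [Nonempty ι] {π : F →* Monoid.PushoutI φ}
    (hπ : Function.Surjective π)
    (hfree : ∀ i (s : K i) (y : Q), of (φ := φ) i s • y = y → of (φ := φ) i s = 1) :
    ∃ ψ : Monoid.PushoutI φ →* (Q → F) ⋊[mulAutArrow] Monoid.PushoutI φ,
      ∀ g, (ψ g).right = g ∧ ∀ y, π ((ψ g).left y) = g := by
  obtain ⟨q, hqof, hqbase⟩ := exists_lift_potentials (Q := Q) hπ hfree
  let i₀ : ι := Classical.arbitrary ι
  let ψ := lift (fun i => coboundaryHom (φ := φ) (q i) i)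
    ((coboundaryHom (q i₀) i₀).comp (φ i₀))
    fun i => MonoidHom.ext fun b => coboundaryHom_apply_eq q hqbase i i₀ b
  have hmul : ∀ g g' y, (ψ (g * g')).left y = (ψ g).left y * (ψ g').left ((ψ g).right⁻¹ • y) :=
    fun g g' y => by rw [map_mul, mul_left, Pi.mul_apply, mulAutArrow_apply_eq]
  have hof : ∀ i (s : K i), (ψ (of i s)).right = of i s ∧
      ∀ y, π ((ψ (of i s)).left y) = of i s := by
    intro i s
    have hqs := hqof i s⁻¹
    rw [map_inv] at hqs
    rw [lift_of, right_coboundaryHom]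
    refine ⟨rfl, fun y => ?_⟩
    rw [left_coboundaryHom, map_mul, map_inv, hqs, mul_inv_rev, inv_inv, mul_inv_cancel_left]
  refine ⟨ψ, fun g => ?_⟩
  induction g using Monoid.PushoutI.induction_on with
  | of i s => exact hof i s
  | base b => rw [← of_apply_eq_base φ i₀]; exact hof i₀ (φ i₀ b)
  | mul g g' hg hg' =>
    refine ⟨by rw [map_mul, mul_right, hg.1, hg'.1], fun y => ?_⟩
    rw [hmul, map_mul, hg.2, hg'.2]

/-- The map from the free group on the elements of the amalgam onto the amalgam splits over the
stabilizer of `y`: evaluating the lift to the wreath product at `y` is a section. -/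
theorem isFreeGroup_stabilizer_of_amalgam [Nonempty ι]
    (hfree : ∀ i (s : K i) (y : Q), of (φ := φ) i s • y = y → of (φ := φ) i s = 1) (y : Q) :
    IsFreeGroup (MulAction.stabilizer (Monoid.PushoutI φ) y) := by
  have hπ : Function.Surjective (FreeGroup.lift (id : Monoid.PushoutI φ → Monoid.PushoutI φ)) :=
    fun g => ⟨FreeGroup.of g, FreeGroup.lift_apply_of⟩
  obtain ⟨ψ, hψ⟩ := exists_wreathLift hπ hfree
  let S := MulAction.stabilizer (Monoid.PushoutI φ) y
  have hy : ∀ g : S, ((ψ.comp S.subtype) g).right • y = y := fun g => by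
    rw [MonoidHom.comp_apply, (hψ _).1]
    exact g.2
  refine isFreeGroup_of_injective (leftAtFixedPoint (ψ.comp S.subtype) y hy) fun g g' h => ?_
  exact Subtype.ext (((hψ g).2 y).symm.trans ((congrArg _ h).trans ((hψ g').2 y)))

theorem isFreeGroup_ker_of_amalgam [Nonempty ι] {L : Type*} [Group L]
    (f : Monoid.PushoutI φ →* L) (hf : ∀ i, Function.Injective (f.comp (of i))) :
    IsFreeGroup f.ker := by
  let _ : MulAction (Monoid.PushoutI φ) L := MulAction.compHom L f
  have hfree : ∀ i (s : K i) (y : L), of (φ := φ) i s • y = y → of (φ := φ) i s = 1 := by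
    intro i s y hy
    have hs : f (of i s) = 1 := mul_eq_right.1 hy
    rw [(injective_iff_map_eq_one _).1 (hf i) s hs, map_one]
  have hker : MulAction.stabilizer (Monoid.PushoutI φ) (1 : L) = f.ker :=
    Subgroup.ext fun g => (congrArg (· = 1) (mul_one (f g))).to_iff
  exact hker ▸ isFreeGroup_stabilizer_of_amalgam hfree 1

end ActionsOfAmalgams

namespace LabelledGraph

variable {V : Type u} {W : Type v}

/-- The labelled graph on `V` pulled back from a labelled graph on `W` along a map `g`. -/
def comap (Γ : LabelledGraph W) (g : V → W) : LabelledGraph V where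
  graph := Γ.graph.comap g
  label := SimpleGraph.EdgeLabeling.mk (fun x y h => Γ.label.get (g x) (g y) h)
    fun _ _ _ => Γ.label.get_comm _ _ _
  two_le_label := by
    rintro ⟨e, he⟩
    induction e using Sym2.ind with
    | h x y => exact Γ.two_le_label _

/-- The inclusion in `Γ` of its pullback along an injective map. -/
def comapInclusion (Γ : LabelledGraph W) {g : V → W} (hg : Function.Injective g) :
    Inclusion (Γ.comap g) Γ where
  toFun := g
  injective := hg
  map_adj h := h
  map_label _ := rfl

theorem comapInclusion_artinMap_injective (Γ : LabelledGraph W) {g : V → W}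
    (hg : Function.Injective g) : Function.Injective (Γ.comapInclusion hg).artinMap :=
  Inclusion.artinMap_injective _ fun _ _ h => h

section Cover

/-- The full labelled subgraph on a set of vertices. -/
abbrev induce (Γ : LabelledGraph V) (s : Set V) : LabelledGraph s :=
  Γ.comap Subtype.val

/-- The inclusion of a full labelled subgraph. -/
abbrev induceInclusion (Γ : LabelledGraph V) (s : Set V) : Inclusion (Γ.induce s) Γ :=
  Γ.comapInclusion Subtype.val_injective

/-- The inclusion between the full labelled subgraphs on two nested sets of vertices. -/
def induceMono (Γ : LabelledGraph V) {s t : Set V} (h : s ⊆ t) :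
    Inclusion (Γ.induce s) (Γ.induce t) where
  toFun := Set.inclusion h
  injective := Set.inclusion_injective h
  map_adj hxy := hxy
  map_label _ := rfl

variable (Γ : LabelledGraph V) {ι : Type*} (S : ι → Set V)

/-- The amalgam of the Artin groups of the full subgraphs on the members of a family of sets of
vertices, over the Artin group of the full subgraph on their intersection. -/
abbrev ArtinAmalgam : Type _ :=
  Monoid.PushoutI fun t => (Γ.induceMono (Set.iInter_subset S t)).artinMap

/-- The homomorphism from the amalgam to the Artin group of `Γ` induced by the inclusions. -/
def artinOfAmalgam : Γ.ArtinAmalgam S →* Γ.ArtinGroup :=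
  Monoid.PushoutI.lift (fun t => (Γ.induceInclusion (S t)).artinMap)
    (Γ.induceInclusion (⋂ t, S t)).artinMap fun t => PresentedGroup.ext fun x => by
      rw [MonoidHom.comp_apply, Inclusion.artinMap_of, Inclusion.artinMap_of,
        Inclusion.artinMap_of]
      rfl

variable {Γ S} in
theorem artinOfAmalgam_of {t : ι} (g : (Γ.induce (S t)).ArtinGroup) :
    Γ.artinOfAmalgam S (Monoid.PushoutI.of t g) = (Γ.induceInclusion (S t)).artinMap g := by
  rw [artinOfAmalgam, Monoid.PushoutI.lift_of]

variable {S} (hcover : ∀ x, ∃ t, x ∈ S t)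

/-- The generator of the amalgam given by a vertex, in an arbitrary factor containing it. -/
noncomputable def amalgamGenerator (x : V) : Γ.ArtinAmalgam S :=
  Monoid.PushoutI.of (hcover x).choose (PresentedGroup.of ⟨x, (hcover x).choose_spec⟩)

variable {Γ} (hinter : ∀ s t, s ≠ t → S s ∩ S t ⊆ ⋂ r, S r)

include hinter in
theorem amalgamGenerator_eq {x : V} {t : ι} (hx : x ∈ S t) :
    Γ.amalgamGenerator hcover x = Monoid.PushoutI.of t (PresentedGroup.of ⟨x, hx⟩) := by
  have hbase : ∀ s (hs : x ∈ S s) (h : x ∈ ⋂ r, S r),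
      (Monoid.PushoutI.of s (PresentedGroup.of ⟨x, hs⟩) : Γ.ArtinAmalgam S) =
        Monoid.PushoutI.base _ (PresentedGroup.of ⟨x, h⟩) := fun s hs h => by
    rw [← Monoid.PushoutI.of_apply_eq_base _ s, Inclusion.artinMap_of]
    rfl
  by_cases hst : (hcover x).choose = t
  · subst hst
    rfl
  · have h := hinter _ _ hst ⟨(hcover x).choose_spec, hx⟩
    rw [amalgamGenerator, hbase _ _ h, hbase _ _ h]

variable (hedge : ∀ x y, Γ.graph.Adj x y → ∃ t, x ∈ S t ∧ y ∈ S t)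

/-- If the edges of `Γ` are covered by full subgraphs with a common pairwise intersection, then its
Artin group is the amalgam of their Artin groups. -/
noncomputable def artinMulEquivAmalgam [Nonempty ι] : Γ.ArtinGroup ≃* Γ.ArtinAmalgam S :=
  MonoidHom.toMulEquiv
    (Γ.artinLift (Γ.amalgamGenerator hcover) fun x y h => by
      obtain ⟨t, hx, hy⟩ := hedge x y h
      rw [amalgamGenerator_eq hcover hinter hx, amalgamGenerator_eq hcover hinter hy,
        ← map_alternatingProd, ← map_alternatingProd]
      exact congrArg _ ((Γ.induce (S t)).alternatingProd_of_comm (x := ⟨x, hx⟩) (y := ⟨y, hy⟩) h))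
    (Γ.artinOfAmalgam S)
    (PresentedGroup.ext fun x => by
      rw [MonoidHom.comp_apply, artinLift_of, amalgamGenerator, artinOfAmalgam_of,
        Inclusion.artinMap_of]
      rfl)
    (Monoid.PushoutI.hom_ext_nonempty fun t => PresentedGroup.ext fun x => by
      rw [MonoidHom.comp_apply, MonoidHom.comp_apply, artinOfAmalgam_of, Inclusion.artinMap_of,
        artinLift_of]
      exact amalgamGenerator_eq hcover hinter x.2)

include hcover hinter hedge in
theorem isFreeGroup_ker_of_cover [Nonempty ι] {L : Type*} [Group L] (f : Γ.ArtinGroup →* L)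
    (hf : ∀ t, Function.Injective (f.comp (Γ.induceInclusion (S t)).artinMap)) :
    IsFreeGroup f.ker := by
  let e := (artinMulEquivAmalgam hcover hinter hedge).symm
  have : IsFreeGroup (f.comp e.toMonoidHom).ker := isFreeGroup_ker_of_amalgam _ fun t => by
    have h : (f.comp e.toMonoidHom).comp (Monoid.PushoutI.of t) =
        f.comp (Γ.induceInclusion (S t)).artinMap :=
      MonoidHom.ext fun x => congrArg f (artinOfAmalgam_of x)
    rw [h]
    exact hf t
  exact isFreeGroup_ker_of_comp_mulEquiv f e

end Cover

/-- The composition of two inclusions. -/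
def Inclusion.comp {U : Type*} {Γ₀ : LabelledGraph U} {Γ₁ : LabelledGraph V} {Γ₂ : LabelledGraph W}
    (j : Inclusion Γ₁ Γ₂) (i : Inclusion Γ₀ Γ₁) : Inclusion Γ₀ Γ₂ where
  toFun := j.toFun ∘ i.toFun
  injective := j.injective.comp i.injective
  map_adj h := j.map_adj (i.map_adj h)
  map_label h := (j.map_label (i.map_adj h)).trans (i.map_label h)

theorem Inclusion.artinMap_comp {U : Type*} {Γ₀ : LabelledGraph U} {Γ₁ : LabelledGraph V}
    {Γ₂ : LabelledGraph W} (j : Inclusion Γ₁ Γ₂) (i : Inclusion Γ₀ Γ₁) :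
    (j.comp i).artinMap = j.artinMap.comp i.artinMap := by
  refine PresentedGroup.ext fun x => ?_
  rw [MonoidHom.comp_apply, artinMap_of, artinMap_of, artinMap_of]
  rfl

namespace AddsEdge

variable {Γ₁ Γ₂ : LabelledGraph V} {a b : V} (h : AddsEdge Γ₁ Γ₂ a b)
include h

theorem adj_of_adj_of_ne {x y c : V} (hc : c = a ∨ c = b) (hx : x ≠ c) (hy : y ≠ c)
    (hxy : Γ₂.graph.Adj x y) : Γ₁.graph.Adj x y := by
  refine ((h.adj_iff x y).1 hxy).resolve_right fun heq => ?_
  grind [Sym2.eq_iff]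

theorem isFreeGroup_ker : IsFreeGroup h.inclusion.artinMap.ker := by
  let c : Bool → V := fun t => cond t a b
  have hcover : ∀ x, ∃ t, x ≠ c t := fun x => by
    by_cases hx : x = a
    · exact ⟨false, fun hxb => h.ne (hx.symm.trans hxb)⟩
    · exact ⟨true, hx⟩
  have hinter : ∀ s t, s ≠ t → ∀ x, x ≠ c s ∧ x ≠ c t → ∀ r, x ≠ c r := by
    simp only [c]
    grind
  have hedge : ∀ x y, Γ₁.graph.Adj x y → ∃ t, x ≠ c t ∧ y ≠ c t := fun x y hxy => by
    have hab := h.ne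
    have hnot := h.not_adj
    have hnot' := fun hba => hnot (Γ₁.graph.adj_symm hba)
    simp only [c, Bool.exists_bool]
    grind [hxy.ne]
  refine isFreeGroup_ker_of_cover (S := fun t => {c t}ᶜ) hcover
    (fun s t hst x hx => Set.mem_iInter.2 (hinter s t hst x hx)) hedge _ fun t => ?_
  rw [← Inclusion.artinMap_comp]
  exact Inclusion.artinMap_injective _ fun x y =>
    h.adj_of_adj_of_ne (by cases t <;> simp [c]) x.2 y.2

end AddsEdge

end LabelledGraph

section PolyFree

variable {G : Type u} {H : Type v} [Group G] [Group H]

theorem isFreeGroup_quotient_of_ker_eq [IsFreeGroup H] (f : G →* H) {K : Subgroup G}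
    (hK : f.ker = K) : ∃ _ : K.Normal, IsFreeGroup (G ⧸ K) := by
  subst hK
  exact ⟨inferInstance,
    isFreeGroup_of_injective (QuotientGroup.kerLift f) (QuotientGroup.kerLift_injective f)⟩

/-- Pulling back a chain of subgroups along a homomorphism, and adding the trivial subgroup. -/
def comapChain (f : G →* H) (C : ℕ → Subgroup H) : ℕ → Subgroup G
  | 0 => ⊥
  | i + 1 => (C i).comap f

theorem comapChain_step (f : G →* H) [IsFreeGroup f.ker] {C : ℕ → Subgroup H} (h0 : C 0 = ⊥)
    {n : ℕ} (h : ∀ i < n, C i ≤ C (i + 1) ∧ ∃ _ : ((C i).subgroupOf (C (i + 1))).Normal,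
      IsFreeGroup (C (i + 1) ⧸ (C i).subgroupOf (C (i + 1)))) :
    ∀ i < n + 1, comapChain f C i ≤ comapChain f C (i + 1) ∧
      ∃ _ : ((comapChain f C i).subgroupOf (comapChain f C (i + 1))).Normal,
        IsFreeGroup (comapChain f C (i + 1) ⧸
          (comapChain f C i).subgroupOf (comapChain f C (i + 1))) := by
  intro i hi
  cases i with
  | zero =>
    have hker : comapChain f C 1 = f.ker := by
      rw [comapChain, h0, MonoidHom.comap_bot]
    refine ⟨bot_le, ?_⟩
    rw [hker, comapChain]
    exact isFreeGroup_quotient_of_ker_eq (MonoidHom.id f.ker) (by simp)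
  | succ i =>
    obtain ⟨hle, hn, hfree⟩ := h i (by lia)
    refine ⟨Subgroup.comap_mono hle, ?_⟩
    refine isFreeGroup_quotient_of_ker_eq
      ((QuotientGroup.mk' ((C i).subgroupOf (C (i + 1)))).comp (f.subgroupComap (C (i + 1)))) ?_
    ext x
    simp only [MonoidHom.mem_ker, MonoidHom.comp_apply, QuotientGroup.mk'_apply,
      QuotientGroup.eq_one_iff, Subgroup.mem_subgroupOf]
    rfl

theorem IsPolyFree.of_hom (f : G →* H) [IsFreeGroup f.ker] (h : IsPolyFree H) : IsPolyFree G := by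
  obtain ⟨n, C, h0, hn, hstep⟩ := h
  exact ⟨n + 1, comapChain f C, rfl, by rw [comapChain, hn, Subgroup.comap_top],
    comapChain_step f h0 hstep⟩

theorem IsNormallyPolyFree.of_hom (f : G →* H) [IsFreeGroup f.ker] (h : IsNormallyPolyFree H) :
    IsNormallyPolyFree G := by
  obtain ⟨n, C, h0, hn, hnorm, hstep⟩ := h
  refine ⟨n + 1, comapChain f C, rfl, by rw [comapChain, hn, Subgroup.comap_top], ?_,
    comapChain_step f h0 hstep⟩
  intro i hi
  cases i with
  | zero => exact Subgroup.normal_bot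
  | succ i => exact (hnorm i (by lia)).comap f

theorem finiteIndex_comap (f : G →* H) (K : Subgroup H) [K.FiniteIndex] :
    (K.comap f).FiniteIndex := by
  refine ⟨?_⟩
  rw [Subgroup.index_comap]
  exact fun h => K.index_ne_zero_of_finite (Subgroup.index_eq_zero_of_relIndex_eq_zero h)

theorem isFreeGroup_ker_subgroupComap (f : G →* H) [IsFreeGroup f.ker] (K : Subgroup H) :
    IsFreeGroup (f.subgroupComap K).ker :=
  isFreeGroup_of_injective
    (((K.comap f).subtype.comp (f.subgroupComap K).ker.subtype).codRestrict f.ker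
      fun x => congrArg Subtype.val x.2)
    fun _ _ hxy => Subtype.ext (Subtype.ext (congrArg (fun z : f.ker => (z : G)) hxy))

theorem IsVirtuallyPolyFree.of_hom (f : G →* H) [IsFreeGroup f.ker] (h : IsVirtuallyPolyFree H) :
    IsVirtuallyPolyFree G := by
  obtain ⟨K, hK, h⟩ := h
  have := isFreeGroup_ker_subgroupComap f K
  exact ⟨K.comap f, finiteIndex_comap f K, h.of_hom (f.subgroupComap K)⟩

theorem IsVirtuallyNormallyPolyFree.of_hom (f : G →* H) [IsFreeGroup f.ker]
    (h : IsVirtuallyNormallyPolyFree H) : IsVirtuallyNormallyPolyFree G := by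
  obtain ⟨K, hK, h⟩ := h
  have := isFreeGroup_ker_subgroupComap f K
  exact ⟨K.comap f, finiteIndex_comap f K, h.of_hom (f.subgroupComap K)⟩

end PolyFree

namespace LabelledGraph

variable {V : Type u} {W : Type v}

/-- The labelled graph obtained by deleting the edges in a set. -/
def deleteEdges (Γ : LabelledGraph V) (E : Set (Sym2 V)) : LabelledGraph V where
  graph := Γ.graph.deleteEdges E
  label := SimpleGraph.EdgeLabeling.mk
    (fun x y h => Γ.label.get x y (SimpleGraph.deleteEdges_le E h))
    fun _ _ _ => Γ.label.get_comm _ _ _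
  two_le_label := by
    rintro ⟨e, he⟩
    induction e using Sym2.ind with
    | h x y => exact Γ.two_le_label _

theorem deleteEdges_adj {Γ : LabelledGraph V} {E : Set (Sym2 V)} {x y : V} :
    (Γ.deleteEdges E).graph.Adj x y ↔ Γ.graph.Adj x y ∧ s(x, y) ∉ E :=
  SimpleGraph.deleteEdges_adj

theorem addsEdge_deleteEdges_insert {Γ : LabelledGraph V} {E : Set (Sym2 V)} {a b : V}
    (hab : Γ.graph.Adj a b) (hE : s(a, b) ∉ E) :
    AddsEdge (Γ.deleteEdges (insert s(a, b) E)) (Γ.deleteEdges E) a b where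
  ne := hab.ne
  not_adj h := (deleteEdges_adj.1 h).2 (Set.mem_insert _ _)
  adj_iff x y := by
    rw [deleteEdges_adj, deleteEdges_adj, Set.mem_insert_iff, not_or]
    constructor
    · tauto
    · rintro (h | h)
      · exact ⟨h.1, h.2.2⟩
      · exact ⟨Γ.graph.mem_edgeSet.1 (h ▸ Γ.graph.mem_edgeSet.2 hab), h ▸ hE⟩
  label_eq _ _ _ := rfl

variable {P : ∀ (G : Type u) [Group G], Prop}
  (hP : ∀ {G H : Type u} [Group G] [Group H] (f : G →* H), IsFreeGroup f.ker → P H → P G)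

include hP

theorem prop_artinGroup_deleteEdges {Γ : LabelledGraph V} {E : Set (Sym2 V)} (hE : E.Finite)
    (hEΓ : E ⊆ Γ.graph.edgeSet) (h : P Γ.ArtinGroup) : P (Γ.deleteEdges E).ArtinGroup := by
  induction E, hE using Set.Finite.induction_on with
  | empty =>
    let i : Inclusion (Γ.deleteEdges ∅) Γ :=
      { toFun := id
        injective := Function.injective_id
        map_adj := fun hxy => (deleteEdges_adj.1 hxy).1
        map_label := fun _ => rfl }
    have hinj := i.artinMap_injective fun x y hxy => deleteEdges_adj.2 ⟨hxy, Set.notMem_empty _⟩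
    exact hP i.artinMap (isFreeGroup_ker_of_injective hinj) h
  | @insert e E he _ ih =>
    obtain ⟨heΓ, hsub⟩ := Set.insert_subset_iff.1 hEΓ
    induction e using Sym2.ind with
    | h a b =>
      exact hP _ (addsEdge_deleteEdges_insert (Γ.graph.mem_edgeSet.1 heΓ) he).isFreeGroup_ker
        (ih hsub)

theorem Inclusion.prop_artinGroup {Q : ∀ (H : Type v) [Group H], Prop}
    (hQ : ∀ {G : Type u} {H : Type v} [Group G] [Group H] (f : G →* H),
      IsFreeGroup f.ker → Q H → P G)
    {Γ₁ : LabelledGraph V} {Γ₂ : LabelledGraph W} (i : Inclusion Γ₁ Γ₂)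
    (hfin : ((Γ₂.graph.comap i.toFun).edgeSet \ Γ₁.graph.edgeSet).Finite)
    (h : Q Γ₂.ArtinGroup) : P Γ₁.ArtinGroup := by
  let E := (Γ₂.graph.comap i.toFun).edgeSet \ Γ₁.graph.edgeSet
  let j : Inclusion Γ₁ ((Γ₂.comap i.toFun).deleteEdges E) :=
    { toFun := id
      injective := Function.injective_id
      map_adj := fun hxy => deleteEdges_adj.2 ⟨i.map_adj hxy, fun hE => hE.2 hxy⟩
      map_label := i.map_label }
  have hj : Function.Injective j.artinMap := j.artinMap_injective fun x y hxy =>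
    have ⟨hadj, hE⟩ := deleteEdges_adj.1 hxy
    not_not.1 fun hΓ₁ => hE ⟨hadj, hΓ₁⟩
  have hcomap : P (Γ₂.comap i.toFun).ArtinGroup :=
    hQ _ (isFreeGroup_ker_of_injective (Γ₂.comapInclusion_artinMap_injective i.injective)) h
  exact hP j.artinMap (isFreeGroup_ker_of_injective hj)
    (prop_artinGroup_deleteEdges hP hfin Set.sdiff_subset hcomap)

end LabelledGraph

theorem mainTheorem10_general :
    (∀ (V : Type u) (Γ₁ Γ₂ : LabelledGraph V) (a b : V)
      (h : LabelledGraph.AddsEdge Γ₁ Γ₂ a b),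
      IsFreeGroup h.inclusion.artinMap.ker) ∧
    (∀ (V : Type u) (W : Type v) (Γ₁ : LabelledGraph V) (Γ₂ : LabelledGraph W)
      (i : LabelledGraph.Inclusion Γ₁ Γ₂),
      ((Γ₂.graph.comap i.toFun).edgeSet \ Γ₁.graph.edgeSet).Finite →
      (IsPolyFree Γ₂.ArtinGroup → IsPolyFree Γ₁.ArtinGroup) ∧
      (IsNormallyPolyFree Γ₂.ArtinGroup → IsNormallyPolyFree Γ₁.ArtinGroup) ∧
      (IsVirtuallyPolyFree Γ₂.ArtinGroup → IsVirtuallyPolyFree Γ₁.ArtinGroup) ∧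
      (IsVirtuallyNormallyPolyFree Γ₂.ArtinGroup → IsVirtuallyNormallyPolyFree Γ₁.ArtinGroup)) :=
  ⟨fun _ _ _ _ _ h => h.isFreeGroup_ker, fun _ _ _ _ i hfin =>
    ⟨i.prop_artinGroup (fun f _ h => h.of_hom f) (fun f _ h => h.of_hom f) hfin,
      i.prop_artinGroup (fun f _ h => h.of_hom f) (fun f _ h => h.of_hom f) hfin,
      i.prop_artinGroup (fun f _ h => h.of_hom f) (fun f _ h => h.of_hom f) hfin,
      i.prop_artinGroup (fun f _ h => h.of_hom f) (fun f _ h => h.of_hom f) hfin⟩⟩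

theorem mainTheorem10 :
    (∀ (V : Type u) [Finite V] (Γ₁ Γ₂ : LabelledGraph V) (a b : V)
      (h : LabelledGraph.AddsEdge Γ₁ Γ₂ a b),
      IsFreeGroup h.inclusion.artinMap.ker) ∧
    (∀ (V : Type u) (W : Type v) [Finite V] [Finite W]
      (Γ₁ : LabelledGraph V) (Γ₂ : LabelledGraph W) (_ : LabelledGraph.Inclusion Γ₁ Γ₂),
      (IsPolyFree Γ₂.ArtinGroup → IsPolyFree Γ₁.ArtinGroup) ∧
      (IsNormallyPolyFree Γ₂.ArtinGroup → IsNormallyPolyFree Γ₁.ArtinGroup) ∧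
      (IsVirtuallyPolyFree Γ₂.ArtinGroup → IsVirtuallyPolyFree Γ₁.ArtinGroup) ∧
      (IsVirtuallyNormallyPolyFree Γ₂.ArtinGroup → IsVirtuallyNormallyPolyFree Γ₁.ArtinGroup)) :=
  ⟨fun V _ => mainTheorem10_general.{u, v}.1 V,
    fun V W _ _ Γ₁ Γ₂ i => mainTheorem10_general.2 V W Γ₁ Γ₂ i (Set.toFinite _)⟩
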